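/- For spaces $X,Z$ say that $Z$ has the same deck as $X$ if every space $X\setminus\{x\}$, $x\in X$, is homeomorphic to some $Z\setminus\{z\}$, $z\in Z$, and conversely; $X$ is reconstructible if every space with the same deck as $X$ is homeomorphic to $X$. Let $\mathbb N=\{1,2,\dots\}$. **Construction.** For a closed cube $C=\{x\in\mathbb R^3: d_\infty(x,c)\le r\}$ let $a_C(x)=2r\bigl(x-(\tfrac12,\tfrac12,\tfrac12)\bigr)+c$, and for $A\subset I^3=[0,1]^3$ write $A^{C}=a_C(A)$. For a continuum $E\subset[\tfrac14,\tfrac34]^2\times\{\tfrac12\}$ and a dense subset $D=\{d_k:k\in\mathbb N\}$ of $E$ (enumerated, repetitions allowed) let $F^{E,D}_k$ be the closed $d_\infty$-ball of radius $2^{-2k-1}$ around $d_k+(0,0,2^{-2k})$, and let $C_{E,D}=E\cup\bigcup_k F^{E,D}_k$. Given such pairs $(E_f,D_f)$ for all finite words $f$ over $\mathbb N$, put $X_0=F_\emptyset=I^3$, $F_{f^\frown k}=(F_k^{E_f,D_f})^{F_f}$ and $$X_{n+1}=\Bigl(X_n\setminus\bigcup_{f\in\mathbb N^n}F_f\Bigr)\cup\bigcup_{f\in\mathbb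 N^n}(C_{E_f,D_f})^{F_f},\qquad X=\bigcap_n X_n .$$ **Choice of the list.** Let $E^0,E^1,E^2,\dots$ be pairwise non-homeomorphic continua with more than one point, contained in $[\tfrac14,\tfrac34]^2\times\{\tfrac12\}$, and for each $n\ge 0$ let $(d^n_k)_{k\in\mathbb N}$ be a sequence enumerating a dense subset $D^n$ of $E^n$, partitioned into finite non-empty blocks of consecutive terms, which are indexed in increasing order by the integers $m>n$, such that the block with index $m$ is $2^{-m}$-dense in $E^n$ (each point of $E^n$ has $d_\infty$-distance at most $2^{-m}$ from some term of the block). Put $E_\emptyset=E^0$, $D_\emptyset=D^0$; and if $(E_f,D_f)=(E^m,D^m)$ and $k\in\mathbb N$, let $(E_{f^\frown k},D_{f^\frown k})=(E^i,D^i)$, where $i>m$ is the index of the block that contains the $k$-th term of $(d^m_k)_{k\in\mathbb N}$. **Theorem.** Such choices exist, and for every such choice the resulting space $X\subset\mathbb R^3$ is a compact metrizable space that is not reconstructible, and in which each component with more than one point appears only finitely often, i.e. only finitely many components of $X$ are homeomorphic to it. -/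

import Mathlib

open Topology

noncomputable section

namespace Recon

/-! ### Topological reconstruction -/

universe u

/-- `X` and `Z` have the same deck: every card `X \ {x}` is homeomorphic to some card `Z \ {z}`,
and conversely. -/
def SameDeck (X Z : Type u) [TopologicalSpace X] [TopologicalSpace Z] : Prop :=
  (∀ x : X, ∃ z : Z, Nonempty (↥({x}ᶜ : Set X) ≃ₜ ↥({z}ᶜ : Set Z))) ∧
  (∀ z : Z, ∃ x : X, Nonempty (↥({x}ᶜ : Set X) ≃ₜ ↥({z}ᶜ : Set Z)))

/-- `X` is (topologically) reconstructible: every space with the same deck is homeomorphic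
to `X`. A space with the same deck is in bijection with `X`, so letting `Z` range over
the universe of `X` loses nothing. -/
def Reconstructible (X : Type u) [TopologicalSpace X] : Prop :=
  ∀ (Z : Type u) [TopologicalSpace Z], SameDeck X Z → Nonempty (X ≃ₜ Z)

/-! ### Cubes in `ℝ³`

`Fin 3 → ℝ` carries the sup metric, so that closed balls are the closed axis-parallel cubes. -/

/-- `ℝ³` with the sup metric. -/
abbrev R3 : Type := Fin 3 → ℝ

/-- The centre `(1/2, 1/2, 1/2)` of the unit cube `I³`. -/
def mid : R3 := fun _ => 1 / 2

/-- A closed cube, given by its centre and half of its side length. -/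
structure Cube where
  center : R3
  radius : ℝ

/-- The set of points of a cube. -/
def Cube.carrier (C : Cube) : Set R3 := Metric.closedBall C.center C.radius

/-- The unit cube `I³ = [0,1]³`. -/
def unitCube : Cube := ⟨mid, 1 / 2⟩

/-- The natural affine map `a_C : x ↦ 2r(x - (1/2,1/2,1/2)) + c` taking `I³` onto the cube `C`. -/
def Cube.aff (C : Cube) (x : R3) : R3 := (2 * C.radius) • (x - mid) + C.center

/-- The relativization of `A` to the cube `C`. -/
def Cube.rel (C : Cube) (A : Set R3) : Set R3 := C.aff '' A

/-- The relativization of a cube `Q` to the cube `C`, again as a cube. -/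
def Cube.relCube (C Q : Cube) : Cube := ⟨C.aff Q.center, 2 * C.radius * Q.radius⟩

/-- `Cube.relCube` is the relativization on the level of sets. -/
theorem Cube.carrier_relCube (C Q : Cube) (hC : 0 < C.radius) :
    (C.relCube Q).carrier = C.rel Q.carrier := by
  have hr : 0 < 2 * C.radius := by positivity
  have key : ∀ x y : R3, dist (C.aff x) (C.aff y) = 2 * C.radius * dist x y := by
    intro x y
    simp only [Cube.aff, dist_add_right, dist_smul₀, dist_sub_right, Real.norm_eq_abs,
      abs_of_pos hr]
  ext p
  constructor
  · intro hp
    have hq : C.aff ((2 * C.radius)⁻¹ • (p - C.center) + mid) = p := by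
      simp only [Cube.aff, add_sub_cancel_right, smul_smul, mul_inv_cancel₀ hr.ne', one_smul,
        sub_add_cancel]
    refine ⟨(2 * C.radius)⁻¹ • (p - C.center) + mid, ?_, hq⟩
    have h1 : dist p (C.aff Q.center) ≤ 2 * C.radius * Q.radius := hp
    rw [← hq, key] at h1
    exact le_of_mul_le_mul_left h1 hr
  · rintro ⟨q, hq, rfl⟩
    have h1 : dist q Q.center ≤ Q.radius := hq
    have h2 : dist (C.aff q) (C.aff Q.center) ≤ 2 * C.radius * Q.radius := by
      rw [key]; gcongr
    exact h2

/-! ### The basic building block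

Sequences are indexed by `k = 0, 1, 2, …` here, so that the term with index `k` is the
`(k+1)`-st one. -/

/-- The cube with centre `d_j + (0, 0, 2^{-2j})` and radius `2^{-2j-1}`, where `j = k + 1`. -/
def smallCube (d : ℕ → R3) (k : ℕ) : Cube :=
  ⟨d k + ![0, 0, (1 / 2) ^ (2 * (k + 1))], (1 / 2) ^ (2 * (k + 1) + 1)⟩

/-- The building block `C_{E,D}`: the continuum `E` and all the small cubes. -/
def block (E : Set R3) (d : ℕ → R3) : Set R3 := E ∪ ⋃ k, (smallCube d k).carrier

/-! ### The recursive construction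

The input is a family of sets `E f` with enumerated subsets `{d f k : k}`, where `f` runs over the
finite words in natural numbers. A word is a list with its last letter first: `k :: f` is the word
`f` followed by the letter `k`. -/

/-- The cube `F_f`. -/
def cube (d : List ℕ → ℕ → R3) : List ℕ → Cube
  | [] => unitCube
  | k :: f => (cube d f).relCube (smallCube (d f) k)

/-- The `n`-th stage `X_n`; in stage `n + 1` each cube `F_f`, with `f` of length `n`, is replaced
by the building block of `f` relativized to it. The stages begin with `X_0 = I³`. -/
def stage (E : List ℕ → Set R3) (d : List ℕ → ℕ → R3) : ℕ → Set R3
  | 0 => unitCube.carrier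
  | n + 1 => (stage E d n \ ⋃ (f : List ℕ) (_ : f.length = n), (cube d f).carrier) ∪
      ⋃ (f : List ℕ) (_ : f.length = n), (cube d f).rel (block (E f) (d f))

/-- The space `⋂ n, X_n` given by the construction. -/
def limitSpace (E : List ℕ → Set R3) (d : List ℕ → ℕ → R3) : Set R3 := ⋂ n, stage E d n

/-! ### The special list of continua -/

/-- The square `[1/4, 3/4]² × {1/2}`. -/
def square : Set R3 :=
  {x | x 0 ∈ Set.Icc (1 / 4 : ℝ) (3 / 4) ∧ x 1 ∈ Set.Icc (1 / 4 : ℝ) (3 / 4) ∧ x 2 = 1 / 2}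

/-- Admissible input. The `E n` are pairwise non-homeomorphic non-trivial continua in the square,
and `d n` enumerates a countable dense subset of `E n`. The monotone function `lab n`, with range
`{m | n < m}`, partitions the sequence `d n` into consecutive finite non-empty blocks indexed by
the numbers `m > n`: the block with index `m` consists of the terms `d n k` with `lab n k = m`.
It has to be `2^{-m}`-dense in `E n`. -/
structure Admissible (E : ℕ → Set R3) (d : ℕ → ℕ → R3) (lab : ℕ → ℕ → ℕ) : Prop where
  subset_square : ∀ n, E n ⊆ square
  isCompact : ∀ n, IsCompact (E n)
  isConnected : ∀ n, IsConnected (E n)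
  nontrivial : ∀ n, (E n).Nontrivial
  not_homeomorphic : ∀ i j, i ≠ j → IsEmpty (↥(E i) ≃ₜ ↥(E j))
  mem : ∀ n k, d n k ∈ E n
  dense : ∀ n, E n ⊆ closure (Set.range (d n))
  lab_monotone : ∀ n, Monotone (lab n)
  range_lab : ∀ n, Set.range (lab n) = Set.Ioi n
  block_dense : ∀ n m, n < m → ∀ x ∈ E n, ∃ k, lab n k = m ∧ dist x (d n k) ≤ (1 / 2) ^ m

/-- The index of the continuum placed at a word: the empty word gets `E 0`, and if `f` gets `E m`,
then `f` followed by `k` gets `E i`, where `i` is the index of the block of `d m` that contains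
the `k`-th term. -/
def wordType (lab : ℕ → ℕ → ℕ) : List ℕ → ℕ
  | [] => 0
  | k :: f => lab (wordType lab f) k

/-- The space obtained from `E`, `d`, `lab`. -/
def finSpace (E : ℕ → Set R3) (d : ℕ → ℕ → R3) (lab : ℕ → ℕ → ℕ) : Set R3 :=
  limitSpace (fun f => E (wordType lab f)) (fun f => d (wordType lab f))

/-- Every non-trivial component of `X` appears only finitely often: only finitely many components
of `X` are homeomorphic to it. -/
def FinitelyRepeatedComponents (X : Type*) [TopologicalSpace X] : Prop :=
  ∀ x : X, (connectedComponent x).Nontrivial →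
    {C : Set X | (∃ y : X, C = connectedComponent y) ∧
      Nonempty (↥C ≃ₜ ↥(connectedComponent x))}.Finite

end Recon

end

namespace Recon

open Set Filter

/-! ### Geometry of the cubes -/

/-! Let `T m` be the space of the same construction begun with `E m` instead of `E 0`. Peeling off
the outermost cube shows that `T m` is `E m` together with disjoint clopen copies of the spaces `T
(lab m k)`, contracted by at most 1/4 and accumulating only at `E m`. The rest of the argument for a
given list uses only this description, recorded in `TreeSystem`.

Two kinds of limits occur. Every point is the limit of disjoint open copies of almost all `T n` that
avoid it (`TreeSystem.convergingCopies`): near a point of a continuum these come from the dense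
blocks, and near any other point from siblings of the cubes around it. Moreover, placing a copy of
`T (n+1)` in each `T n` by a fixed map `ψ n` gives nested copies that shrink to a single point
(`TreeSystem.exists_nestedLimit`).

If `x` is such a nested limit and `z ≠ x`, a Hilbert hotel argument
(`nonempty_homeomorph_compl_pair`) shows that X∖{z} and X∖{z, x} are homeomorphic. Hence X∖{x} has
the same deck as X, the card at `x` itself being handled by a second nested limit `y`. But X∖{x} is
not compact, so X is not reconstructible (`not_reconstructible_of_copies`).

The non-trivial components are exactly the copies of the continua, one for each word. Types strictly
increase along a word and each block is finite, so each type belongs to finitely many words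
(`TreeSystem.finite_wordType_eq`). Admissible lists exist: stars with n + 3 legs are told apart by
the number of pieces left by removing a point (`HasCut.le_card`). -/

theorem Cube.aff_injective {C : Cube} (hC : 0 < C.radius) : Function.Injective C.aff := by
  intro x y h
  have h1 : (2 * C.radius) • (x - mid) = (2 * C.radius) • (y - mid) := by
    simpa [Cube.aff] using h
  have h2 := smul_right_injective R3 (by positivity : (2 * C.radius) ≠ 0) h1
  simpa using h2

theorem Cube.dist_aff {C : Cube} (hC : 0 < C.radius) (x y : R3) :
    dist (C.aff x) (C.aff y) = 2 * C.radius * dist x y := by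
  have hr : 0 < 2 * C.radius := by positivity
  simp only [Cube.aff, dist_add_right, dist_smul₀, dist_sub_right, Real.norm_eq_abs,
    abs_of_pos hr]

theorem Cube.continuous_aff (C : Cube) : Continuous C.aff := by
  unfold Cube.aff; fun_prop

theorem Cube.aff_relCube (C Q : Cube) (x : R3) : (C.relCube Q).aff x = C.aff (Q.aff x) := by
  ext i
  simp only [Cube.aff, Cube.relCube, Pi.add_apply, Pi.smul_apply, Pi.sub_apply, smul_eq_mul]
  ring

theorem Cube.rel_relCube (C Q : Cube) (A : Set R3) : (C.relCube Q).rel A = C.rel (Q.rel A) := by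
  ext y
  simp [Cube.rel, Cube.aff_relCube]

theorem Cube.relCube_assoc (C Q S : Cube) :
    (C.relCube Q).relCube S = C.relCube (Q.relCube S) := by
  simp only [Cube.relCube, Cube.mk.injEq]
  exact ⟨Cube.aff_relCube C Q S.center, by ring⟩

theorem unitCube_relCube (Q : Cube) : unitCube.relCube Q = Q := by
  cases Q
  simp [Cube.relCube, unitCube, Cube.aff]

theorem relCube_unitCube (Q : Cube) : Q.relCube unitCube = Q := by
  cases Q
  simp only [Cube.relCube, unitCube, Cube.aff, sub_self, smul_zero, zero_add, Cube.mk.injEq,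
    true_and]
  ring

theorem unitCube_rel (A : Set R3) : unitCube.rel A = A := by
  have : unitCube.aff = id := by
    funext x; simp [unitCube, Cube.aff]
  simp [Cube.rel, this]

theorem Cube.rel_unitCube {C : Cube} (hC : 0 < C.radius) :
    C.rel unitCube.carrier = C.carrier := by
  rw [← Cube.carrier_relCube C _ hC, relCube_unitCube]

theorem smallCube_radius_pos (d : ℕ → R3) (k : ℕ) : 0 < (smallCube d k).radius := by
  simp only [smallCube]; positivity

theorem two_mul_smallCube_radius (d : ℕ → R3) (k : ℕ) :
    2 * (smallCube d k).radius = (1 / 4) ^ (k + 1) := by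
  simp only [smallCube]
  rw [pow_succ, pow_mul]; norm_num; ring

theorem smallCube_aff_apply (d : ℕ → R3) (k : ℕ) (x : R3) (i : Fin 3) :
    (smallCube d k).aff x i =
      (1 / 4) ^ (k + 1) * (x i - 1 / 2) + d k i + ![0, 0, (1 / 4) ^ (k + 1)] i := by
  rw [Cube.aff, two_mul_smallCube_radius]
  simp only [smallCube, pow_mul, mid, Pi.add_apply, Pi.smul_apply, Pi.sub_apply, smul_eq_mul]
  norm_num [add_assoc]

theorem mem_unitCube {x : R3} : x ∈ unitCube.carrier ↔ ∀ i, |x i - 1 / 2| ≤ 1 / 2 := by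
  simp only [unitCube, Cube.carrier, Metric.mem_closedBall]
  rw [dist_pi_le_iff (by norm_num)]
  rfl

theorem quarter_pow_le (k : ℕ) : (1 / 4 : ℝ) ^ (k + 1) ≤ 1 / 4 := by
  rw [pow_succ]
  have : (1 / 4 : ℝ) ^ k ≤ 1 := pow_le_one₀ (by norm_num) (by norm_num)
  linarith

theorem mul_bounds {p t : ℝ} (hp : 0 < p) (ht : |t| ≤ 1 / 2) :
    -(p / 2) ≤ p * t ∧ p * t ≤ p / 2 := by
  obtain ⟨h1, h2⟩ := abs_le.1 ht
  constructor <;> nlinarith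

theorem square_subset_unitCube : square ⊆ unitCube.carrier := by
  rintro x ⟨h0, h1, h2⟩
  rw [mem_unitCube]
  intro i
  rw [abs_le]
  fin_cases i <;> constructor <;> simp <;> linarith [h0.1, h0.2, h1.1, h1.2]

/-- With p = 4^{-(k+1)}, the cube occupies the heights from 1/2 + p/2 to 1/2 + 3p/2. The next value
of p is at most p/4 and 3p/8 < p/2, so these slabs are disjoint for different `k` and lie strictly
above the square. All disjointness below rests on this. -/
theorem smallCube_aff_height {d : ℕ → R3} {k : ℕ} (hd : d k ∈ square) {x : R3}
    (hx : x ∈ unitCube.carrier) :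
    1 / 2 + (1 / 4) ^ (k + 1) / 2 ≤ (smallCube d k).aff x 2 ∧
      (smallCube d k).aff x 2 ≤ 1 / 2 + 3 * (1 / 4) ^ (k + 1) / 2 := by
  rw [smallCube_aff_apply, hd.2.2]
  have h := abs_le.1 (mem_unitCube.1 hx 2)
  have hp : (0 : ℝ) < (1 / 4) ^ (k + 1) := by positivity
  simp only [Matrix.cons_val]
  constructor <;> nlinarith

theorem smallCube_aff_mem {d : ℕ → R3} {k : ℕ} (hd : d k ∈ square) {x : R3}
    (hx : x ∈ unitCube.carrier) : (smallCube d k).aff x ∈ unitCube.carrier := by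
  have hp : (0 : ℝ) < (1 / 4) ^ (k + 1) := by positivity
  have hq := quarter_pow_le k
  obtain ⟨h0, h1, h2⟩ := hd
  rw [mem_unitCube] at hx ⊢
  intro i
  have hi := mul_bounds hp (hx i)
  rw [smallCube_aff_apply, abs_le]
  generalize (1 / 4 : ℝ) ^ (k + 1) = p at *
  fin_cases i <;> simp only [Fin.zero_eta, Fin.mk_one, Fin.reduceFinMk, Matrix.cons_val, h2] at * <;>
    constructor <;> linarith [h0.1, h0.2, h1.1, h1.2]

theorem smallCube_rel_subset {d : ℕ → R3} {k : ℕ} (hd : d k ∈ square) {A : Set R3}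
    (hA : A ⊆ unitCube.carrier) : (smallCube d k).rel A ⊆ unitCube.carrier := by
  rintro _ ⟨x, hx, rfl⟩
  exact smallCube_aff_mem hd (hA hx)

theorem smallCube_aff_dist {d : ℕ → R3} {k : ℕ} {x : R3}
    (hx : x ∈ unitCube.carrier) :
    dist ((smallCube d k).aff x) (d k) ≤ 2 * (1 / 4) ^ (k + 1) := by
  have hp : (0 : ℝ) < (1 / 4) ^ (k + 1) := by positivity
  rw [dist_pi_le_iff (by positivity)]
  intro i
  have hi := mul_bounds hp (mem_unitCube.1 hx i)
  rw [smallCube_aff_apply, Real.dist_eq, abs_le]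
  generalize (1 / 4 : ℝ) ^ (k + 1) = p at *
  fin_cases i <;> simp only [Fin.zero_eta, Fin.mk_one, Fin.reduceFinMk, Matrix.cons_val] at * <;>
    constructor <;> linarith

theorem square_disjoint_smallCube_rel {d : ℕ → R3} {k : ℕ} (hd : d k ∈ square) {A : Set R3}
    (hA : A ⊆ unitCube.carrier) : Disjoint square ((smallCube d k).rel A) := by
  rw [Set.disjoint_left]
  rintro _ hs ⟨x, hx, rfl⟩
  have hp : (0 : ℝ) < (1 / 4) ^ (k + 1) := by positivity
  have := (smallCube_aff_height hd (hA hx)).1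
  rw [hs.2.2] at this
  linarith

theorem smallCube_aff_ne {d : ℕ → R3} (hd : ∀ k, d k ∈ square) {k l : ℕ} (hkl : k ≠ l) {x y : R3}
    (hx : x ∈ unitCube.carrier) (hy : y ∈ unitCube.carrier) :
    (smallCube d k).aff x ≠ (smallCube d l).aff y := by
  wlog h : k < l generalizing k l x y
  · exact (this hkl.symm hy hx (lt_of_le_of_ne (not_lt.1 h) hkl.symm)).symm
  intro he
  have h1 := (smallCube_aff_height (hd k) hx).1
  have h2 := (smallCube_aff_height (hd l) hy).2
  have h3 : (1 / 4 : ℝ) ^ (l + 1) ≤ (1 / 4) ^ (k + 1) * (1 / 4) := by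
    rw [← pow_succ]
    exact pow_le_pow_of_le_one (by norm_num) (by norm_num) (by omega)
  have hp : (0 : ℝ) < (1 / 4) ^ (k + 1) := by positivity
  rw [he] at h1
  linarith

theorem smallCube_rel_disjoint {d : ℕ → R3} (hd : ∀ k, d k ∈ square) {k l : ℕ} (hkl : k ≠ l)
    {A B : Set R3} (hA : A ⊆ unitCube.carrier) (hB : B ⊆ unitCube.carrier) :
    Disjoint ((smallCube d k).rel A) ((smallCube d l).rel B) := by
  rw [Set.disjoint_left]
  rintro _ ⟨x, hx, rfl⟩ ⟨y, hy, h⟩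
  exact smallCube_aff_ne hd hkl (hA hx) (hB hy) h.symm

/-! ### The stages satisfy a recursion from the root -/

theorem cube_radius_pos (d : List ℕ → ℕ → R3) (f : List ℕ) : 0 < (cube d f).radius := by
  induction f with
  | nil => norm_num [cube, unitCube]
  | cons k f ih =>
    have := smallCube_radius_pos (d f) k
    simp only [cube, Cube.relCube]
    positivity

/-- The last entry of a list is the first letter of the word, so appending `[k]` inserts a new
outermost cube. -/
theorem cube_append_singleton (d : List ℕ → ℕ → R3) (k : ℕ) (g : List ℕ) :
    cube d (g ++ [k]) = (smallCube (d []) k).relCube (cube (fun h => d (h ++ [k])) g) := by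
  induction g with
  | nil => simp [cube, unitCube_relCube, relCube_unitCube]
  | cons j g ih =>
    simp only [List.cons_append, cube, ih, Cube.relCube_assoc]

theorem block_subset_unitCube {E : Set R3} {d : ℕ → R3} (hE : E ⊆ square)
    (hd : ∀ k, d k ∈ square) : block E d ⊆ unitCube.carrier := by
  refine Set.union_subset (hE.trans square_subset_unitCube) (Set.iUnion_subset fun k => ?_)
  rw [← Cube.rel_unitCube (smallCube_radius_pos d k)]
  exact smallCube_rel_subset (hd k) subset_rfl

theorem cube_carrier_subset {d : List ℕ → ℕ → R3} (hd : ∀ f k, d f k ∈ square) (f : List ℕ) :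
    (cube d f).carrier ⊆ unitCube.carrier := by
  induction f with
  | nil => exact subset_rfl
  | cons k f ih =>
    refine subset_trans ?_ ih
    simp only [cube]
    rw [Cube.carrier_relCube _ _ (cube_radius_pos d f),
      ← Cube.rel_unitCube (smallCube_radius_pos (d f) k)]
    conv_rhs => rw [← Cube.rel_unitCube (cube_radius_pos d f)]
    exact Set.image_mono (smallCube_rel_subset (hd f k) subset_rfl)

theorem stage_subset_unitCube {E : List ℕ → Set R3} {d : List ℕ → ℕ → R3}
    (hE : ∀ f, E f ⊆ square) (hd : ∀ f k, d f k ∈ square) (n : ℕ) :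
    stage E d n ⊆ unitCube.carrier := by
  induction n with
  | zero => exact subset_rfl
  | succ n ih =>
    refine Set.union_subset (Set.sdiff_subset.trans ih)
      (Set.iUnion₂_subset fun f _ => subset_trans ?_ (cube_carrier_subset hd f))
    conv_rhs => rw [← Cube.rel_unitCube (cube_radius_pos d f)]
    exact Set.image_mono (block_subset_unitCube (hE f) (hd f))

theorem exists_append_singleton {n : ℕ} {f : List ℕ} (hf : f.length = n + 1) :
    ∃ g k, f = g ++ [k] ∧ g.length = n := by
  have hne : f ≠ [] := by rintro rfl; simp at hf
  exact ⟨f.dropLast, f.getLast hne, (List.dropLast_append_getLast hne).symm, by simp [hf]⟩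

/-- The stages are defined by refining the innermost cubes; this is the recursion from the outermost
level, which exhibits the self-similarity. -/
theorem stage_succ_eq {E : List ℕ → Set R3} {d : List ℕ → ℕ → R3}
    (hE : ∀ f, E f ⊆ square) (hd : ∀ f k, d f k ∈ square) (n : ℕ) :
    stage E d (n + 1) = E [] ∪ ⋃ k, (smallCube (d []) k).rel
      (stage (fun g => E (g ++ [k])) (fun g => d (g ++ [k])) n) := by
  induction n with
  | zero =>
    have h0 : ∀ f : List ℕ, f.length = 0 ↔ f = [] := fun f => List.length_eq_zero_iff
    simp only [stage, h0, Set.iUnion_iUnion_eq_left, cube, Set.sdiff_self,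
      Set.empty_union, unitCube_rel, block,
      Cube.rel_unitCube (smallCube_radius_pos _ _)]
  | succ n ih =>
    have hU : (⋃ (f : List ℕ) (_ : f.length = n + 1), (cube d f).carrier) =
        ⋃ k, (smallCube (d []) k).rel
          (⋃ (g : List ℕ) (_ : g.length = n), (cube (fun h => d (h ++ [k])) g).carrier) := by
      ext x
      simp only [Cube.rel, Set.image_iUnion, Set.mem_iUnion]
      constructor
      · rintro ⟨f, hf, hx⟩
        obtain ⟨g, k, rfl, hg⟩ := exists_append_singleton hf
        rw [cube_append_singleton, Cube.carrier_relCube _ _ (smallCube_radius_pos _ _)] at hx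
        exact ⟨k, g, hg, hx⟩
      · rintro ⟨k, g, hg, hx⟩
        refine ⟨g ++ [k], by simp [hg], ?_⟩
        rw [cube_append_singleton, Cube.carrier_relCube _ _ (smallCube_radius_pos _ _)]
        exact hx
    have hW : (⋃ (f : List ℕ) (_ : f.length = n + 1), (cube d f).rel (block (E f) (d f))) =
        ⋃ k, (smallCube (d []) k).rel
          (⋃ (g : List ℕ) (_ : g.length = n), (cube (fun h => d (h ++ [k])) g).rel
            (block (E (g ++ [k])) (d (g ++ [k])))) := by
      ext x
      simp only [Cube.rel, Set.image_iUnion, Set.mem_iUnion]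
      constructor
      · rintro ⟨f, hf, hx⟩
        obtain ⟨g, k, rfl, hg⟩ := exists_append_singleton hf
        rw [cube_append_singleton] at hx
        exact ⟨k, g, hg, (Cube.rel_relCube _ _ _).subset hx⟩
      · rintro ⟨k, g, hg, hx⟩
        refine ⟨g ++ [k], by simp [hg], ?_⟩
        rw [cube_append_singleton]
        exact (Cube.rel_relCube _ _ _).superset hx
    have hP := fun k => stage_subset_unitCube (E := fun g => E (g ++ [k]))
      (d := fun g => d (g ++ [k])) (fun g => hE _) (fun g => hd _) n
    have hV : ∀ k, (⋃ (g : List ℕ) (_ : g.length = n),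
        (cube (fun h => d (h ++ [k])) g).carrier) ⊆ unitCube.carrier := fun k =>
      Set.iUnion₂_subset fun g _ => cube_carrier_subset (fun _ => hd _) g
    rw [stage, hU, hW, ih]
    simp only [stage]
    generalize hv : (fun k => ⋃ (g : List ℕ) (_ : g.length = n),
        (cube (fun h => d (h ++ [k])) g).carrier) = V at hV
    have hv' : ∀ k, (⋃ (g : List ℕ) (_ : g.length = n),
        (cube (fun h => d (h ++ [k])) g).carrier) = V k := fun k => congrFun hv k
    simp only [hv'] at hV ⊢
    -- Removal of the innermost cubes can be done separately in each outermost cube, because these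
    -- are disjoint from each other and from the first continuum.
    have key : (E [] ∪ ⋃ k, (smallCube (d []) k).rel
          (stage (fun g => E (g ++ [k])) (fun g => d (g ++ [k])) n)) \
          (⋃ k, (smallCube (d []) k).rel (V k)) =
        E [] ∪ ⋃ k, (smallCube (d []) k).rel
          (stage (fun g => E (g ++ [k])) (fun g => d (g ++ [k])) n \ V k) := by
      rw [Set.union_sdiff_distrib, Set.iUnion_sdiff]
      congr 1
      · rw [sdiff_eq_left, Set.disjoint_iUnion_right]
        exact fun k => (square_disjoint_smallCube_rel (hd [] k) (hV k)).mono_left (hE [])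
      · refine Set.iUnion_congr fun k => ?_
        rw [Cube.rel, Cube.rel, Set.image_sdiff (Cube.aff_injective (smallCube_radius_pos _ _))]
        ext x
        constructor
        · rintro ⟨h1, h2⟩
          exact ⟨h1, fun h => h2 (Set.mem_iUnion.2 ⟨k, h⟩)⟩
        · rintro ⟨h1, h2⟩
          refine ⟨h1, fun h => ?_⟩
          obtain ⟨l, hl⟩ := Set.mem_iUnion.1 h
          rcases eq_or_ne k l with rfl | hkl
          · exact h2 hl
          · exact Set.disjoint_left.1 (smallCube_rel_disjoint (hd []) hkl (hP k) (hV l)) h1 hl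
    rw [key, Set.union_assoc, ← Set.iUnion_union_distrib]
    simp only [Cube.rel, Set.image_union]

theorem limitSpace_eq {E : List ℕ → Set R3} {d : List ℕ → ℕ → R3}
    (hE : ∀ f, E f ⊆ square) (hd : ∀ f k, d f k ∈ square) :
    limitSpace E d = E [] ∪ ⋃ k, (smallCube (d []) k).rel
      (limitSpace (fun g => E (g ++ [k])) (fun g => d (g ++ [k]))) := by
  have hP := fun k => stage_subset_unitCube (E := fun g => E (g ++ [k]))
      (d := fun g => d (g ++ [k])) (fun g => hE _) (fun g => hd _)
  ext x
  constructor
  · intro hx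
    have hx' : ∀ n, x ∈ stage E d n := Set.mem_iInter.1 hx
    by_cases hxE : x ∈ E []
    · exact Or.inl hxE
    right
    have h1 : ∀ n, ∃ k, x ∈ (smallCube (d []) k).rel
        (stage (fun g => E (g ++ [k])) (fun g => d (g ++ [k])) n) := by
      intro n
      have := hx' (n + 1)
      rw [stage_succ_eq hE hd] at this
      exact Set.mem_iUnion.1 (this.resolve_left hxE)
    -- Each stage offers its own index; by disjointness of the small cubes it must be the one found
    -- here, so intersection and union commute.
    obtain ⟨k, y, hy, rfl⟩ := h1 0
    refine Set.mem_iUnion.2 ⟨k, y, Set.mem_iInter.2 fun n => ?_, rfl⟩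
    obtain ⟨l, z, hz, he⟩ := h1 n
    rcases eq_or_ne k l with rfl | hkl
    · rwa [← Cube.aff_injective (smallCube_radius_pos _ _) he]
    · exact (smallCube_aff_ne (hd []) hkl (hP k 0 hy) (hP l n hz) he.symm).elim
  · intro hx
    refine Set.mem_iInter.2 fun n => ?_
    cases n with
    | zero =>
      rcases hx with hx | hx
      · exact square_subset_unitCube (hE [] hx)
      · obtain ⟨k, hk⟩ := Set.mem_iUnion.1 hx
        exact smallCube_rel_subset (hd [] k) ((Set.iInter_subset _ 0).trans (hP k 0)) hk
    | succ n =>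
      rw [stage_succ_eq hE hd]
      exact Set.union_subset_union_right _
        (Set.iUnion_mono fun k => Set.image_mono (Set.iInter_subset _ n)) hx

/-! ### Closedness -/

/-- Only finitely many `K k` leave a given neighbourhood of `E`, since `K k` lies within
2·4^{-(k+1)} of a point of `E`. -/
theorem isClosed_union_iUnion {E : Set R3} (hE : IsClosed E) {d : ℕ → R3} (hd : ∀ k, d k ∈ E)
    {K : ℕ → Set R3} (hK : ∀ k, IsClosed (K k))
    (hKd : ∀ k, ∀ x ∈ K k, dist x (d k) ≤ 2 * (1 / 4) ^ (k + 1)) :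
    IsClosed (E ∪ ⋃ k, K k) := by
  rw [← closure_subset_iff_isClosed]
  intro y hy
  by_contra hcon
  have hyE : y ∉ E := fun h => hcon (Or.inl h)
  have hpos : 0 < Metric.infDist y E := (hE.notMem_iff_infDist_pos ⟨_, hd 0⟩).1 hyE
  obtain ⟨N, hN⟩ := exists_pow_lt_of_lt_one (show (0 : ℝ) < Metric.infDist y E / 4 by positivity)
    (show (1 / 4 : ℝ) < 1 by norm_num)
  have hsub : E ∪ ⋃ k, K k ⊆
      Metric.cthickening (Metric.infDist y E / 2) E ∪ ⋃ k ∈ Finset.range N, K k := by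
    rintro x (hx | hx)
    · exact Or.inl (Metric.self_subset_cthickening _ hx)
    · obtain ⟨k, hk⟩ := Set.mem_iUnion.1 hx
      rcases lt_or_ge k N with hkN | hkN
      · exact Or.inr (Set.mem_biUnion (Finset.mem_coe.2 (Finset.mem_range.2 hkN)) hk)
      · refine Or.inl (Metric.mem_cthickening_of_dist_le _ _ _ _ (hd k) ((hKd k x hk).trans ?_))
        have : (1 / 4 : ℝ) ^ (k + 1) ≤ (1 / 4) ^ N :=
          pow_le_pow_of_le_one (by norm_num) (by norm_num) (by omega)
        linarith
  have hcl : IsClosed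
      (Metric.cthickening (Metric.infDist y E / 2) E ∪ ⋃ k ∈ Finset.range N, K k) :=
    Metric.isClosed_cthickening.union
      ((Finset.range N).finite_toSet.isClosed_biUnion fun k _ => hK k)
  rcases closure_minimal hsub hcl hy with h | h
  · rw [Metric.cthickening_eq_preimage_infEDist] at h
    have h2 : Metric.infEDist y E ≤ ENNReal.ofReal (Metric.infDist y E / 2) := h
    have h3 : Metric.infDist y E ≤ Metric.infDist y E / 2 :=
      ENNReal.toReal_le_of_le_ofReal (by positivity) h2
    linarith
  · obtain ⟨k, _, hk⟩ := Set.mem_iUnion₂.1 h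
    exact hcon (Or.inr (Set.mem_iUnion.2 ⟨k, hk⟩))

theorem Cube.isClosed_rel {C : Cube} {A : Set R3} (hA : IsClosed A)
    (hAu : A ⊆ unitCube.carrier) : IsClosed (C.rel A) :=
  (((isCompact_closedBall _ _).of_isClosed_subset hA hAu).image C.continuous_aff).isClosed

theorem isClosed_stage {E : List ℕ → Set R3} {d : List ℕ → ℕ → R3}
    (hE : ∀ f, E f ⊆ square) (hd : ∀ f k, d f k ∈ E f) (hc : ∀ f, IsClosed (E f)) (n : ℕ) :
    IsClosed (stage E d n) := by
  induction n generalizing E d with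
  | zero => exact Metric.isClosed_closedBall
  | succ n ih =>
    have hP := fun k => stage_subset_unitCube (E := fun g => E (g ++ [k]))
      (d := fun g => d (g ++ [k])) (fun g => hE _) (fun g l => hE _ (hd _ l)) n
    rw [stage_succ_eq hE (fun f k => hE f (hd f k))]
    refine isClosed_union_iUnion (hc []) (hd []) (fun k => ?_) ?_
    · exact Cube.isClosed_rel (ih (fun _ => hE _) (fun _ => hd _) (fun _ => hc _)) (hP k)
    · rintro k _ ⟨y, hy, rfl⟩
      exact smallCube_aff_dist (hP k hy)

theorem isClosed_limitSpace {E : List ℕ → Set R3} {d : List ℕ → ℕ → R3}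
    (hE : ∀ f, E f ⊆ square) (hd : ∀ f k, d f k ∈ E f) (hc : ∀ f, IsClosed (E f)) :
    IsClosed (limitSpace E d) :=
  isClosed_iInter fun n => isClosed_stage hE hd hc n

/-! ### The spaces with an arbitrary initial type -/

/-- The type of a word if the empty word has type `m`. -/
def wordTypeFrom (lab : ℕ → ℕ → ℕ) (m : ℕ) : List ℕ → ℕ
  | [] => m
  | k :: f => lab (wordTypeFrom lab m f) k

theorem wordTypeFrom_zero (lab : ℕ → ℕ → ℕ) (f : List ℕ) :
    wordTypeFrom lab 0 f = wordType lab f := by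
  induction f with
  | nil => rfl
  | cons k f ih => simp [wordTypeFrom, wordType, ih]

theorem wordTypeFrom_append_singleton (lab : ℕ → ℕ → ℕ) (m k : ℕ) (g : List ℕ) :
    wordTypeFrom lab m (g ++ [k]) = wordTypeFrom lab (lab m k) g := by
  induction g with
  | nil => rfl
  | cons j g ih => simp [wordTypeFrom, ih]

/-- The analogue of `finSpace` that begins with the continuum `E m`. -/
def finSpaceFrom (E : ℕ → Set R3) (d : ℕ → ℕ → R3) (lab : ℕ → ℕ → ℕ) (m : ℕ) : Set R3 :=
  limitSpace (fun f => E (wordTypeFrom lab m f)) (fun f => d (wordTypeFrom lab m f))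

theorem finSpaceFrom_zero (E : ℕ → Set R3) (d : ℕ → ℕ → R3) (lab : ℕ → ℕ → ℕ) :
    finSpaceFrom E d lab 0 = finSpace E d lab := by
  simp only [finSpaceFrom, finSpace, wordTypeFrom_zero]

section
variable {E : ℕ → Set R3} {d : ℕ → ℕ → R3} {lab : ℕ → ℕ → ℕ}

theorem Admissible.finSpaceFrom_eq (h : Admissible E d lab) (m : ℕ) :
    finSpaceFrom E d lab m =
      E m ∪ ⋃ k, (smallCube (d m) k).rel (finSpaceFrom E d lab (lab m k)) := by
  rw [finSpaceFrom, limitSpace_eq (fun _ => h.subset_square _)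
    (fun _ k => h.subset_square _ (h.mem _ k))]
  simp only [wordTypeFrom_append_singleton]
  rfl

theorem Admissible.isClosed_finSpaceFrom (h : Admissible E d lab) (m : ℕ) :
    IsClosed (finSpaceFrom E d lab m) :=
  isClosed_limitSpace (fun _ => h.subset_square _) (fun _ => h.mem _)
    (fun _ => (h.isCompact _).isClosed)

theorem finSpaceFrom_subset (m : ℕ) :
    finSpaceFrom E d lab m ⊆ unitCube.carrier :=
  Set.iInter_subset _ 0

theorem Admissible.isCompact_finSpaceFrom (h : Admissible E d lab) (m : ℕ) :
    IsCompact (finSpaceFrom E d lab m) :=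
  (isCompact_closedBall _ _).of_isClosed_subset (h.isClosed_finSpaceFrom m)
    (finSpaceFrom_subset m)

end

/-! ### Open embeddings of topological sums -/

theorem isOpenEmbedding_sumElim {A B X : Type*} [TopologicalSpace A] [TopologicalSpace B]
    [TopologicalSpace X] {f : A → X} {g : B → X} (hf : IsOpenEmbedding f)
    (hg : IsOpenEmbedding g) (hd : ∀ a b, f a ≠ g b) : IsOpenEmbedding (Sum.elim f g) :=
  .of_continuous_injective_isOpenMap (hf.continuous.sumElim hg.continuous)
    (hf.injective.sumElim hg.injective hd) (hf.isOpenMap.sumElim hg.isOpenMap)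

theorem isOpenEmbedding_sigma {ι : Type*} {A : ι → Type*} {X : Type*}
    [∀ i, TopologicalSpace (A i)] [TopologicalSpace X] {f : ∀ i, A i → X}
    (hf : ∀ i, IsOpenEmbedding (f i)) (hd : ∀ i j a b, f i a = f j b → i = j) :
    IsOpenEmbedding (fun x : Σ i, A i => f x.1 x.2) := by
  refine .of_continuous_injective_isOpenMap (continuous_sigma fun i => (hf i).continuous) ?_
    (isOpenMap_sigma.2 fun i => (hf i).isOpenMap)
  rintro ⟨i, a⟩ ⟨j, b⟩ h
  obtain rfl := hd i j a b h
  exact congrArg (Sigma.mk i) ((hf i).injective h)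

theorem nonempty_homeomorph_of_range_eq {D X : Type*} [TopologicalSpace D] [TopologicalSpace X]
    {f g : D → X} (hf : IsEmbedding f) (hg : IsEmbedding g) {A B : Set X} (hA : range f = A)
    (hB : range g = B) : Nonempty (A ≃ₜ B) := by
  subst hA hB
  exact ⟨hf.toHomeomorph.symm.trans hg.toHomeomorph⟩

/-- A point other than `z` has a neighbourhood that meets only finitely many of the sets. -/
theorem isClosed_insert_iUnion {X : Type*} [TopologicalSpace X] [T2Space X] {z : X}
    {K : ℕ → Set X} (hK : ∀ i, IsClosed (K i)) (hz : ∀ U ∈ 𝓝 z, ∀ᶠ i in atTop, K i ⊆ U) :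
    IsClosed (insert z (⋃ i, K i)) := by
  rw [← isOpen_compl_iff, isOpen_iff_mem_nhds]
  intro y hy
  simp only [mem_compl_iff, mem_insert_iff, mem_iUnion, not_or, not_exists] at hy
  obtain ⟨U, V, hU, hV, hzU, hyV, hUV⟩ := t2_separation (Ne.symm hy.1)
  obtain ⟨N, hN⟩ := eventually_atTop.1 (hz U (hU.mem_nhds hzU))
  have h1 : ⋂ i ∈ Finset.range N, (K i)ᶜ ∈ 𝓝 y :=
    (Finset.iInter_mem_sets _).2 fun i _ => (hK i).isOpen_compl.mem_nhds (hy.2 i)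
  filter_upwards [h1, hV.mem_nhds hyV] with w hw hwV
  simp only [mem_compl_iff, mem_insert_iff, mem_iUnion, not_or, not_exists]
  refine ⟨fun h => Set.disjoint_left.1 hUV hzU (h ▸ hwV), fun i hi => ?_⟩
  rcases lt_or_ge i N with h | h
  · exact Set.mem_iInter₂.1 hw i (Finset.mem_range.2 h) hi
  · exact Set.disjoint_left.1 hUV (hN i h hi) hwV

/-! ### Converging sequences of copies -/

section copies

variable {T : ℕ → Type} [∀ n, TopologicalSpace (T n)]

/-- Almost all `T n` have open copies in `Y \ {z}` that are pairwise disjoint and converge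
to `z`. -/
def ConvergingCopies (T : ℕ → Type) [∀ n, TopologicalSpace (T n)] {Y : Type}
    [TopologicalSpace Y] (z : Y) : Prop :=
  ∃ (N : ℕ) (V : ∀ n, T n → Y), (∀ n ≥ N, IsOpenEmbedding (V n)) ∧ (∀ n ≥ N, z ∉ range (V n)) ∧
    (∀ n ≥ N, ∀ m ≥ N, ∀ a b, V n a = V m b → n = m) ∧
    ∀ U ∈ 𝓝 z, ∀ᶠ n in atTop, range (V n) ⊆ U

/-- The point `x` is the limit of nested open copies of the `T n`, nested by means of the
maps `ψ n`. -/
def NestedLimit (ψ : ∀ n, T (n + 1) → T n) {Y : Type} [TopologicalSpace Y] (x : Y) : Prop :=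
  ∃ (N : ℕ) (e : ∀ n, T n → Y), (∀ n ≥ N, IsOpenEmbedding (e n)) ∧
    (∀ n ≥ N, e (n + 1) = e n ∘ ψ n) ∧ (∀ n ≥ N, x ∈ range (e n)) ∧
    ∀ U ∈ 𝓝 x, ∀ᶠ n in atTop, range (e n) ⊆ U

theorem ConvergingCopies.map {Y Y' : Type} [TopologicalSpace Y] [TopologicalSpace Y'] {z : Y}
    (h : ConvergingCopies T z) {g : Y → Y'} (hg : IsOpenEmbedding g) :
    ConvergingCopies T (g z) := by
  obtain ⟨N, V, h1, h2, h3, h4⟩ := h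
  refine ⟨N, fun n => g ∘ V n, fun n hn => hg.comp (h1 n hn), ?_, ?_, ?_⟩
  · rintro n hn ⟨a, ha⟩
    exact h2 n hn ⟨a, hg.injective ha⟩
  · exact fun n hn m hm a b hab => h3 n hn m hm a b (hg.injective hab)
  · intro U hU
    filter_upwards [h4 _ (hg.continuous.continuousAt.preimage_mem_nhds hU)] with n hn
    rintro _ ⟨a, rfl⟩
    exact hn ⟨a, rfl⟩

/-- Hilbert hotel. Let disjoint copies `W n`, n ≥ M, converge to `z`, with `W M` the copy `e M`
around `x`. Each copy of `T n` splits into the inner copy of `T (n+1)` given by `ψ n` and the shell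
outside it. The shell of `W n` is sent to the n-th shell around `x`, and the inner part of `W n` is
expanded to all of `W (n+1)`. The shells around `x` fill `e M` except for `x`. With `z` removed all
pieces are open, so no continuity has to be checked at a limit. -/
theorem nonempty_homeomorph_compl_pair [∀ n, CompactSpace (T n)] [∀ n, T2Space (T n)]
    {ψ : ∀ n, T (n + 1) → T n}
    (hψ : ∀ n, IsOpenEmbedding (ψ n)) {X : Type} [TopologicalSpace X] [T2Space X] {x z : X}
    (hx : NestedLimit ψ x) (hz : ConvergingCopies T z) (hzx : z ≠ x) :
    Nonempty (↥({z}ᶜ : Set X) ≃ₜ ↥({z, x}ᶜ : Set X)) := by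
  obtain ⟨N, V, hV, hzV, hVd, hVz⟩ := hz
  obtain ⟨N', e, he, heψ, hxe, hex⟩ := hx
  obtain ⟨Uz, Ux, hUz, hUx, hzU, hxU, hU⟩ := t2_separation hzx
  obtain ⟨M₁, hM₁⟩ := eventually_atTop.1 (hVz Uz (hUz.mem_nhds hzU))
  obtain ⟨M₂, hM₂⟩ := eventually_atTop.1 (hex Ux (hUx.mem_nhds hxU))
  obtain ⟨M, hMN, hMN', hMM₁, hMM₂⟩ : ∃ M, N ≤ M ∧ N' ≤ M ∧ M₁ ≤ M ∧ M₂ ≤ M :=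
    ⟨N + N' + M₁ + M₂, by omega, by omega, by omega, by omega⟩
  have heanti : ∀ i, range (e (M + i + 1)) ⊆ range (e (M + i)) := by
    intro i
    rw [heψ (M + i) (by omega)]
    exact range_comp_subset_range _ _
  have heanti' : Antitone fun i => range (e (M + i)) := antitone_nat_of_succ_le heanti
  -- the copy `e M` at `x`, followed by copies that converge to `z`
  obtain ⟨W, hWM, hWV⟩ : ∃ W : ∀ n, T n → X, W M = e M ∧ ∀ n, n ≠ M → W n = V n :=
    ⟨fun n => if n = M then e n else V n, by simp, fun n hn => by simp [hn]⟩
  have hW : ∀ n ≥ M, IsOpenEmbedding (W n) := by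
    intro n hn
    rcases eq_or_ne n M with rfl | h
    · rw [hWM]; exact he _ hMN'
    · rw [hWV n h]; exact hV n (by omega)
  have hzW : ∀ n ≥ M, z ∉ range (W n) := by
    intro n hn
    rcases eq_or_ne n M with rfl | h
    · rw [hWM]
      exact fun h => Set.disjoint_left.1 hU hzU (hM₂ _ hMM₂ h)
    · rw [hWV n h]; exact hzV n (by omega)
  have hWe : ∀ n ≥ M, n ≠ M → ∀ a b, e M a ≠ W n b := by
    intro n hn h a b hab
    rw [hWV n h] at hab
    exact Set.disjoint_left.1 hU (hM₁ n (by omega) ⟨b, rfl⟩) (hab ▸ hM₂ _ hMM₂ ⟨a, rfl⟩)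
  have hWd : ∀ n ≥ M, ∀ m ≥ M, ∀ a b, W n a = W m b → n = m := by
    intro n hn m hm a b hab
    rcases eq_or_ne n M with h | h
    · subst h
      by_contra hmn
      rw [hWM] at hab
      exact hWe m hm (Ne.symm hmn) _ _ hab
    · rcases eq_or_ne m M with h' | h'
      · subst h'
        rw [hWM] at hab
        exact (hWe n hn h _ _ hab.symm).elim
      · rw [hWV n h, hWV m h'] at hab
        exact hVd n (by omega) m (by omega) a b hab
  have hWz : ∀ U ∈ 𝓝 z, ∀ᶠ i in atTop, range (W (M + i)) ⊆ U := by
    intro U hU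
    obtain ⟨Q, hQ⟩ := eventually_atTop.1 (hVz U hU)
    refine eventually_atTop.2 ⟨Q + 1, fun i hi => ?_⟩
    rw [hWV _ (by omega)]
    exact hQ _ (by omega)
  let R : Set X := (insert z (⋃ i, range (W (M + i))))ᶜ
  have hR : IsOpen R := (isClosed_insert_iUnion
    (fun i => (isCompact_range (hW (M + i) (by omega)).continuous).isClosed) hWz).isOpen_compl
  have hRW : ∀ (r : R) i a, (r : X) ≠ W (M + i) a := by
    rintro ⟨r, hr⟩ i a rfl
    exact hr (Or.inr (mem_iUnion.2 ⟨i, a, rfl⟩))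
  have hRe : ∀ (r : R) i a, (r : X) ≠ e (M + i) a := by
    intro r i a h
    obtain ⟨b, hb⟩ : e (M + i) a ∈ range (e (M + 0)) := heanti' (Nat.zero_le i) ⟨a, rfl⟩
    refine hRW r 0 b ?_
    rw [h, ← hb]
    exact (congrFun hWM b).symm
  -- The shell of `T n`: what remains outside the inner copy of `T (n+1)`.
  let S : ℕ → Type := fun n => ↥((range (ψ n))ᶜ : Set (T n))
  have hS : ∀ n, IsOpenEmbedding (Subtype.val : S n → T n) := fun n =>
    (isCompact_range (hψ n).continuous).isClosed.isOpen_compl.isOpenEmbedding_subtypeVal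
  have heS : ∀ i j (s : S (M + i)) (t : S (M + j)), i < j → e (M + i) s ≠ e (M + j) t := by
    intro i j s t hij h
    have h1 : e (M + j) t ∈ range (e (M + i + 1)) :=
      heanti' (show i + 1 ≤ j by omega) ⟨t, rfl⟩
    rw [← h, heψ (M + i) (by omega)] at h1
    obtain ⟨a, ha⟩ := h1
    exact s.2 ⟨a, (he (M + i) (by omega)).injective ha⟩
  -- Two open embeddings of one topological sum: the first fills the complement of `z`, the second
  -- the complement of `{z, x}`.
  let f₁ : R ⊕ ((Σ i, S (M + i)) ⊕ (Σ i, T (M + i + 1))) → X :=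
    Sum.elim Subtype.val (Sum.elim (fun x => W (M + x.1) x.2) (fun x => W (M + x.1) (ψ _ x.2)))
  let f₂ : R ⊕ ((Σ i, S (M + i)) ⊕ (Σ i, T (M + i + 1))) → X :=
    Sum.elim Subtype.val (Sum.elim (fun x => e (M + x.1) x.2) (fun x => W (M + x.1 + 1) x.2))
  have hf₁ : IsOpenEmbedding f₁ := by
    refine isOpenEmbedding_sumElim hR.isOpenEmbedding_subtypeVal
      (isOpenEmbedding_sumElim ?_ ?_ ?_) ?_
    · refine isOpenEmbedding_sigma (f := fun i (x : S (M + i)) => W (M + i) x)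
        (fun i => (hW _ (by omega)).comp (hS _)) fun i j a b h => ?_
      have := hWd _ (by omega) _ (by omega) _ _ h
      omega
    · refine isOpenEmbedding_sigma (f := fun i x => W (M + i) (ψ (M + i) x))
        (fun i => (hW _ (by omega)).comp (hψ _)) fun i j a b h => ?_
      have := hWd _ (by omega) _ (by omega) _ _ h
      omega
    · rintro ⟨i, s⟩ ⟨j, t⟩ h
      have hij : M + i = M + j := hWd _ (by omega) _ (by omega) _ _ h
      obtain rfl : i = j := by omega
      exact s.2 ⟨t, ((hW _ (by omega)).injective h).symm⟩
    · rintro r (⟨i, s⟩ | ⟨i, t⟩)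
      · exact hRW r i _
      · exact hRW r i _
  have hf₂ : IsOpenEmbedding f₂ := by
    refine isOpenEmbedding_sumElim hR.isOpenEmbedding_subtypeVal
      (isOpenEmbedding_sumElim ?_ ?_ ?_) ?_
    · refine isOpenEmbedding_sigma (f := fun i (x : S (M + i)) => e (M + i) x)
        (fun i => (he _ (by omega)).comp (hS _)) fun i j a b h => ?_
      rcases lt_trichotomy i j with hij | hij | hij
      · exact (heS i j a b hij h).elim
      · exact hij
      · exact (heS j i b a hij h.symm).elim
    · refine isOpenEmbedding_sigma (f := fun i x => W (M + i + 1) x)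
        (fun i => hW _ (by omega)) fun i j a b h => ?_
      have := hWd _ (by omega) _ (by omega) _ _ h
      omega
    · rintro ⟨i, s⟩ ⟨j, t⟩ h
      obtain ⟨b, hb⟩ : e (M + i) s ∈ range (e (M + 0)) := heanti' (Nat.zero_le i) ⟨_, rfl⟩
      exact hWe (M + j + 1) (by omega) (by omega) b t (hb.trans h)
    · rintro r (⟨i, s⟩ | ⟨i, t⟩)
      · exact hRe r i _
      · exact hRW r (i + 1) _
  refine nonempty_homeomorph_of_range_eq hf₁.isEmbedding hf₂.isEmbedding ?_ ?_
  · ext y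
    constructor
    · rintro ⟨r | ⟨i, s⟩ | ⟨i, t⟩, rfl⟩ h
      · exact r.2 (Or.inl h)
      · exact hzW (M + i) (by omega) ⟨_, h⟩
      · exact hzW (M + i) (by omega) ⟨_, h⟩
    · intro hy
      by_cases hyR : y ∈ R
      · exact ⟨Sum.inl ⟨y, hyR⟩, rfl⟩
      obtain ⟨i, a, rfl⟩ := mem_iUnion.1 ((not_not.1 hyR).resolve_left hy)
      by_cases ha : a ∈ range (ψ (M + i))
      · obtain ⟨b, rfl⟩ := ha
        exact ⟨Sum.inr (Sum.inr ⟨i, b⟩), rfl⟩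
      · exact ⟨Sum.inr (Sum.inl ⟨i, a, ha⟩), rfl⟩
  · ext y
    constructor
    · rintro ⟨r | ⟨i, s⟩ | ⟨i, t⟩, rfl⟩ h
      · rcases h with h | h
        · exact r.2 (Or.inl h)
        · obtain ⟨a, ha⟩ := hxe (M + 0) (by omega)
          exact hRe r 0 a (h.trans ha.symm)
      · rcases h with h | h
        · obtain ⟨b, hb⟩ : e (M + i) s ∈ range (e (M + 0)) := heanti' (Nat.zero_le i) ⟨_, rfl⟩
          exact hzW M le_rfl ⟨b, (congrFun hWM b).trans (hb.trans h)⟩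
        · obtain ⟨a, ha⟩ := hxe (M + i + 1) (by omega)
          rw [heψ (M + i) (by omega)] at ha
          exact s.2 ⟨a, (he (M + i) (by omega)).injective (ha.trans h.symm)⟩
      · rcases h with h | h
        · exact hzW (M + i + 1) (by omega) ⟨_, h⟩
        · obtain ⟨a, ha⟩ := hxe M (by omega)
          exact hWe (M + i + 1) (by omega) (by omega) a t (ha.trans h.symm)
    · intro hy
      have hyz : y ≠ z := fun h => hy (Or.inl h)
      have hyx : y ≠ x := fun h => hy (Or.inr h)
      by_cases hyR : y ∈ R
      · exact ⟨Sum.inl ⟨y, hyR⟩, rfl⟩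
      obtain ⟨i, a, rfl⟩ := mem_iUnion.1 ((not_not.1 hyR).resolve_left hyz)
      cases i with
      | succ i => exact ⟨Sum.inr (Sum.inr ⟨i, a⟩), rfl⟩
      | zero =>
        -- A point of `e M` other than `x` is eventually outside the nested copies. It lies in the
        -- shell of the last copy before the first one that misses it.
        have hlim : ∃ j, W (M + 0) a ∉ range (e (M + j)) := by
          obtain ⟨Q, hQ⟩ := eventually_atTop.1 (hex {W (M + 0) a}ᶜ
            (isOpen_compl_singleton.mem_nhds (Ne.symm hyx)))
          exact ⟨Q, fun h => hQ (M + Q) (by omega) h rfl⟩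
        classical
        have hj := Nat.find_spec hlim
        have hmin : ∀ i < Nat.find hlim, W (M + 0) a ∈ range (e (M + i)) :=
          fun i hi => not_not.1 (Nat.find_min hlim hi)
        generalize Nat.find hlim = j at hj hmin
        cases j with
        | zero => exact (hj ⟨a, (congrFun hWM a).symm⟩).elim
        | succ j =>
          obtain ⟨b, hb⟩ := hmin j (by omega)
          refine ⟨Sum.inr (Sum.inl ⟨j, b, ?_⟩), hb⟩
          rintro ⟨c, rfl⟩
          refine hj ⟨c, ?_⟩
          have : e (M + j + 1) = e (M + j) ∘ ψ (M + j) := heψ (M + j) (by omega)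
          exact (congrFun this c).trans hb

/-- The competitor is X∖{x}: its card at `z` is X∖{z, x}, which is homeomorphic to X∖{z}. -/
theorem not_reconstructible_of_copies [∀ n, CompactSpace (T n)] [∀ n, T2Space (T n)]
    [∀ n, Nonempty (T n)] {ψ : ∀ n, T (n + 1) → T n} (hψ : ∀ n, IsOpenEmbedding (ψ n))
    {X : Type} [TopologicalSpace X] [CompactSpace X] [T2Space X] {x y : X} (hxy : x ≠ y)
    (hx : NestedLimit ψ x) (hy : NestedLimit ψ y) (hz : ∀ z : X, ConvergingCopies T z) :
    ¬ Reconstructible X := by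
  intro hrec
  have hcard : ∀ z : ↥({x}ᶜ : Set X),
      Nonempty (↥({(z : X), x}ᶜ : Set X) ≃ₜ ↥({z}ᶜ : Set ↥({x}ᶜ : Set X))) := by
    intro z
    have hemb : IsEmbedding
        (fun w : ↥({z}ᶜ : Set ↥({x}ᶜ : Set X)) => ((w : ↥({x}ᶜ : Set X)) : X)) :=
      IsEmbedding.subtypeVal.comp IsEmbedding.subtypeVal
    have hrange : range (fun w : ↥({z}ᶜ : Set ↥({x}ᶜ : Set X)) => ((w : ↥({x}ᶜ : Set X)) : X)) =
        {(z : X), x}ᶜ := by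
      ext w
      constructor
      · rintro ⟨w, rfl⟩ (h | h)
        · exact w.2 (Subtype.ext h)
        · exact w.1.2 h
      · intro h
        exact ⟨⟨⟨w, fun hw => h (Or.inr hw)⟩, fun hw => h (Or.inl (congrArg Subtype.val hw))⟩, rfl⟩
    exact ⟨(Homeomorph.setCongr hrange.symm).trans hemb.toHomeomorph.symm⟩
  have hdeck : SameDeck X ↥({x}ᶜ : Set X) := by
    have hne : ∀ z : ↥({x}ᶜ : Set X), Nonempty (↥({(z : X)}ᶜ : Set X) ≃ₜ
        ↥({z}ᶜ : Set ↥({x}ᶜ : Set X))) := by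
      intro z
      obtain ⟨h₁⟩ := nonempty_homeomorph_compl_pair hψ hx (hz z) z.2
      obtain ⟨h₂⟩ := hcard z
      exact ⟨h₁.trans h₂⟩
    refine ⟨fun w => ?_, fun z => ⟨z, hne z⟩⟩
    rcases eq_or_ne w x with rfl | hw
    -- The card at `x` is matched with the card of X∖{x} at `y`, by absorbing `y` with copies that
    -- converge to `x`.
    · obtain ⟨h₁⟩ := nonempty_homeomorph_compl_pair hψ hy (hz w) hxy
      obtain ⟨h₂⟩ := hcard ⟨y, hxy.symm⟩
      exact ⟨⟨y, hxy.symm⟩, ⟨(h₁.trans (Homeomorph.setCongr (by rw [Set.pair_comm]))).trans h₂⟩⟩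
    · exact ⟨⟨w, hw⟩, hne ⟨w, hw⟩⟩
  obtain ⟨h⟩ := hrec _ hdeck
  have hcompact : CompactSpace ↥({x}ᶜ : Set X) := h.compactSpace
  -- Compactness of X∖{x} would make `x` isolated, but non-empty copies that avoid `x` converge to
  -- it.
  have hopen : IsOpen ({x} : Set X) := by
    have := (isCompact_iff_compactSpace.2 hcompact).isClosed.isOpen_compl
    rwa [compl_compl] at this
  obtain ⟨N, V, -, hxV, -, hV⟩ := hz x
  obtain ⟨M, hM⟩ := eventually_atTop.1 (hV {x} (hopen.mem_nhds rfl))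
  obtain ⟨a⟩ := (inferInstance : Nonempty (T (N + M)))
  exact hxV (N + M) (by omega) ⟨a, hM (N + M) (by omega) ⟨a, rfl⟩⟩

end copies

/-! ### Self-similar systems of spaces -/

/-- Compact spaces `T n` of diameter at most `1`, each consisting of a continuum `K n` and of open
copies `φ n k` of the spaces `T (lab n k)`, that lie close to the points `d n k`. -/
structure TreeSystem (lab : ℕ → ℕ → ℕ) (T : ℕ → Type) [∀ n, MetricSpace (T n)]
    (K : ∀ n, Set (T n)) (φ : ∀ n k, T (lab n k) → T n) (d : ∀ n, ℕ → T n) : Prop where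
  isOpenEmbedding : ∀ n k, IsOpenEmbedding (φ n k)
  dist_le_one : ∀ n (x y : T n), dist x y ≤ 1
  dist_child_le : ∀ n k x y, dist (φ n k x) (φ n k y) ≤ 1 / 4 * dist x y
  child_ne : ∀ n k l, k ≠ l → ∀ x y, φ n k x ≠ φ n l y
  core_or_child : ∀ n x, x ∈ K n ∨ ∃ k y, φ n k y = x
  child_notMem_core : ∀ n k x, φ n k x ∉ K n
  dist_child_point : ∀ n k x, dist (φ n k x) (d n k) ≤ 2 * (1 / 4) ^ (k + 1)
  isConnected_core : ∀ n, IsConnected (K n)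
  not_homeomorphic : ∀ i j, i ≠ j → IsEmpty (↥(K i) ≃ₜ ↥(K j))
  lab_monotone : ∀ n, Monotone (lab n)
  range_lab : ∀ n, range (lab n) = Ioi n
  block_dense : ∀ n m, n < m → ∀ x ∈ K n, ∃ k, lab n k = m ∧ dist x (d n k) ≤ (1 / 2) ^ m

/-- The embedding of `T (wordTypeFrom lab m f)` into `T m` that belongs to the word `f`. -/
def wordMap {lab : ℕ → ℕ → ℕ} {T : ℕ → Type} (φ : ∀ n k, T (lab n k) → T n) (m : ℕ) :
    ∀ f : List ℕ, T (wordTypeFrom lab m f) → T m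
  | [] => id
  | k :: f => wordMap φ m f ∘ φ (wordTypeFrom lab m f) k

theorem range_wordMap_cons_subset {lab : ℕ → ℕ → ℕ} {T : ℕ → Type}
    (φ : ∀ n k, T (lab n k) → T n) (m : ℕ) (f : List ℕ) (k : ℕ) :
    range (wordMap φ m (k :: f)) ⊆ range (wordMap φ m f) :=
  range_comp_subset_range _ _

namespace TreeSystem

variable {lab : ℕ → ℕ → ℕ} {T : ℕ → Type} [∀ n, MetricSpace (T n)]
  {K : ∀ n, Set (T n)} {φ : ∀ n k, T (lab n k) → T n} {d : ∀ n, ℕ → T n}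

theorem lt_lab (h : TreeSystem lab T K φ d) (n k : ℕ) : n < lab n k :=
  (h.range_lab n).subset ⟨k, rfl⟩

theorem exists_lab_eq (h : TreeSystem lab T K φ d) {n m : ℕ} (hnm : n < m) : ∃ k, lab n k = m :=
  (h.range_lab n).superset hnm

/-- A monotone labelling that attains m + 1 has left the value `m` by then. -/
theorem finite_lab_eq (h : TreeSystem lab T K φ d) (n m : ℕ) : {k | lab n k = m}.Finite := by
  by_cases hnm : n < m
  · obtain ⟨l, hl⟩ := h.exists_lab_eq (show n < m + 1 by omega)
    refine (finite_lt_nat l).subset fun k (hk : lab n k = m) => ?_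
    by_contra hlk
    have := h.lab_monotone n (not_lt.1 hlk)
    omega
  · refine Set.finite_empty.subset fun k (hk : lab n k = m) => ?_
    have := h.lt_lab n k
    omega

theorem exists_copy (h : TreeSystem lab T K φ d) {n k m : ℕ} (hk : lab n k = m) :
    ∃ v : T m → T n, IsOpenEmbedding v ∧ range v = range (φ n k) ∧
      ∀ x y, dist (v x) (v y) ≤ 1 / 4 * dist x y := by
  subst hk
  exact ⟨φ n k, h.isOpenEmbedding n k, rfl, h.dist_child_le n k⟩

theorem nonempty (h : TreeSystem lab T K φ d) (n : ℕ) : Nonempty (T n) :=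
  ⟨(h.isConnected_core n).nonempty.some⟩

/-! #### Words -/

theorem isOpenEmbedding_wordMap (h : TreeSystem lab T K φ d) (m : ℕ) (f : List ℕ) :
    IsOpenEmbedding (wordMap φ m f) := by
  induction f with
  | nil => exact .id
  | cons k f ih => exact ih.comp (h.isOpenEmbedding _ _)

theorem dist_wordMap_le (h : TreeSystem lab T K φ d) (m : ℕ) (f : List ℕ)
    (x y : T (wordTypeFrom lab m f)) :
    dist (wordMap φ m f x) (wordMap φ m f y) ≤ (1 / 4) ^ f.length * dist x y := by
  induction f with
  | nil =>
    rw [List.length_nil, pow_zero, one_mul]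
    exact le_rfl
  | cons k f ih =>
    refine (ih _ _).trans ?_
    rw [List.length_cons, pow_succ, mul_assoc]
    exact mul_le_mul_of_nonneg_left (h.dist_child_le _ _ _ _) (by positivity)

theorem dist_le_of_mem_range_wordMap (h : TreeSystem lab T K φ d) {m : ℕ} {f : List ℕ} {x y : T m}
    (hx : x ∈ range (wordMap φ m f)) (hy : y ∈ range (wordMap φ m f)) :
    dist x y ≤ (1 / 4) ^ f.length := by
  obtain ⟨x, rfl⟩ := hx
  obtain ⟨y, rfl⟩ := hy
  refine (h.dist_wordMap_le m f x y).trans (mul_le_of_le_one_right (by positivity)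
    (h.dist_le_one _ _ _))

theorem wordMap_cons_ne (h : TreeSystem lab T K φ d) (m : ℕ) (f : List ℕ) {k l : ℕ} (hkl : k ≠ l)
    (x : T (wordTypeFrom lab m (k :: f))) (y : T (wordTypeFrom lab m (l :: f))) :
    wordMap φ m (k :: f) x ≠ wordMap φ m (l :: f) y :=
  fun he => h.child_ne _ k l hkl x y ((h.isOpenEmbedding_wordMap m f).injective he)

theorem isClopen_range_wordMap [∀ n, CompactSpace (T n)] (h : TreeSystem lab T K φ d) (m : ℕ)
    (f : List ℕ) : IsClopen (range (wordMap φ m f)) :=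
  ⟨(isCompact_range (h.isOpenEmbedding_wordMap m f).continuous).isClosed,
    (h.isOpenEmbedding_wordMap m f).isOpen_range⟩

/-- A point lies in the continuum of some word, or it is the only point in the copies along an
infinite word. -/
theorem core_or_branch (h : TreeSystem lab T K φ d) {m : ℕ} (z : T m) :
    (∃ f, z ∈ wordMap φ m f '' K (wordTypeFrom lab m f)) ∨
      ∃ (s : ℕ → List ℕ) (k : ℕ → ℕ), (∀ j, z ∈ range (wordMap φ m (s j))) ∧
        (∀ j, s (j + 1) = k j :: s j) ∧ ∀ j, (s j).length = j := by
  by_cases hz : ∃ f, z ∈ wordMap φ m f '' K (wordTypeFrom lab m f)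
  · exact Or.inl hz
  right
  have hstep : ∀ f : {f : List ℕ // z ∈ range (wordMap φ m f)},
      ∃ k, z ∈ range (wordMap φ m (k :: f.1)) := by
    rintro ⟨f, x, rfl⟩
    rcases h.core_or_child _ x with hx | ⟨k, y, rfl⟩
    · exact (hz ⟨f, x, hx, rfl⟩).elim
    · exact ⟨k, y, rfl⟩
  choose c hc using hstep
  let s : ℕ → {f : List ℕ // z ∈ range (wordMap φ m f)} :=
    fun j => Nat.rec ⟨[], z, rfl⟩ (fun _ f => ⟨c f :: f.1, hc f⟩) j
  refine ⟨fun j => (s j).1, fun j => c (s j), fun j => (s j).2, fun j => rfl, fun j => ?_⟩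
  induction j with
  | zero => rfl
  | succ j ih => exact congrArg (· + 1) ih

/-! #### Converging sequences of copies -/

/-- For each m > n the block with index `m` has a term within 2^{-m} of `z`; the child at that term
is the copy of `T m`. Its position in the sequence tends to infinity with `m`, so its diameter and
its distance from the term vanish as well. -/
theorem convergingCopies_of_mem_core (h : TreeSystem lab T K φ d) {n : ℕ} {z : T n}
    (hz : z ∈ K n) : ConvergingCopies T z := by
  have hk : ∀ m, ∃ k, n < m → lab n k = m ∧ dist z (d n k) ≤ (1 / 2) ^ m := by
    intro m
    by_cases hm : n < m
    · obtain ⟨k, hk⟩ := h.block_dense n m hm z hz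
      exact ⟨k, fun _ => hk⟩
    · exact ⟨0, fun hm' => (hm hm').elim⟩
  choose k hk using hk
  have hv : ∀ m, ∃ v : T m → T n, n < m → IsOpenEmbedding v ∧ range v = range (φ n (k m)) := by
    intro m
    by_cases hm : n < m
    · obtain ⟨v, h1, h2, -⟩ := h.exists_copy (hk m hm).1
      exact ⟨v, fun _ => ⟨h1, h2⟩⟩
    · exact ⟨fun _ => z, fun hm' => (hm hm').elim⟩
  choose v hv using hv
  refine ⟨n + 1, v, fun m hm => (hv m hm).1, ?_, ?_, ?_⟩
  · intro m hm hzm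
    rw [(hv m hm).2] at hzm
    obtain ⟨x, rfl⟩ := hzm
    exact h.child_notMem_core _ _ _ hz
  · intro m hm l hl a b hab
    have h1 : v m a ∈ range (φ n (k m)) := (hv m hm).2 ▸ ⟨a, rfl⟩
    have h2 : v l b ∈ range (φ n (k l)) := (hv l hl).2 ▸ ⟨b, rfl⟩
    obtain ⟨x, hx⟩ := h1
    obtain ⟨y, hy⟩ := h2
    have hkk : k m = k l := by
      by_contra hne
      exact h.child_ne n _ _ hne x y (by rw [hx, hy, hab])
    rw [← (hk m hm).1, ← (hk l hl).1, hkk]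
  · intro U hU
    obtain ⟨ε, hε, hεU⟩ := Metric.mem_nhds_iff.1 hU
    obtain ⟨N, hN⟩ := exists_pow_lt_of_lt_one (show (0 : ℝ) < ε / 4 by positivity)
      (show (1 / 2 : ℝ) < 1 by norm_num)
    -- By monotonicity, `m` above `lab n N` forces the chosen index `k m` above `N`.
    refine eventually_atTop.2 ⟨max (max (n + 1) N) (lab n N + 1), fun m hm => ?_⟩
    have hnm : n < m := by omega
    rw [(hv m hnm).2]
    rintro _ ⟨x, rfl⟩
    apply hεU
    rw [Metric.mem_ball, dist_comm]
    have hkN : N < k m := by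
      by_contra hlt
      have := h.lab_monotone n (not_lt.1 hlt)
      rw [(hk m hnm).1] at this
      omega
    have h1 : (1 / 2 : ℝ) ^ m ≤ (1 / 2) ^ N :=
      pow_le_pow_of_le_one (by norm_num) (by norm_num) (by omega)
    have h2 : (1 / 4 : ℝ) ^ (k m + 1) ≤ (1 / 2) ^ N :=
      (pow_le_pow_left₀ (by norm_num) (by norm_num) _).trans
        (pow_le_pow_of_le_one (by norm_num) (by norm_num) (by omega))
    have h3 := h.dist_child_point n (k m) x
    rw [dist_comm] at h3
    linarith [dist_triangle z (d n (k m)) (φ n (k m) x), (hk m hnm).2]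

/-- Let i₀ < i₁ < … be the types along the branch. For i_{j+1} < n ≤ i_{j+2} the copy of `T n` is a
child at level `j`. It is not the child on the branch, whose type i_{j+1} is smaller, so it avoids
`z`. Each `n` determines one `j`, and `j` tends to infinity with `n`. -/
theorem convergingCopies_of_branch (h : TreeSystem lab T K φ d) {m : ℕ} {z : T m}
    {s : ℕ → List ℕ} {k : ℕ → ℕ} (hz : ∀ j, z ∈ range (wordMap φ m (s j)))
    (hs : ∀ j, s (j + 1) = k j :: s j) (hlen : ∀ j, (s j).length = j) :
    ConvergingCopies T z := by
  obtain ⟨i, hi⟩ : ∃ i : ℕ → ℕ, ∀ j, i j = wordTypeFrom lab m (s j) := ⟨_, fun _ => rfl⟩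
  have hi_succ : ∀ j, i (j + 1) = lab (i j) (k j) := by
    intro j; rw [hi, hi, hs]; rfl
  have hmono : StrictMono i := strictMono_nat_of_lt_succ fun j => by
    rw [hi_succ]; exact h.lt_lab _ _
  have hanti : Antitone fun j => range (wordMap φ m (s j)) := antitone_nat_of_succ_le fun j => by
    rw [hs]; exact range_wordMap_cons_subset φ m (s j) (k j)
  have hv : ∀ n, ∃ (v : T n → T m) (j l : ℕ), i 1 < n → i (j + 1) < n ∧ n ≤ i (j + 2) ∧
      lab (i j) l = n ∧ IsOpenEmbedding v ∧ range v = range (wordMap φ m (l :: s j)) := by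
    intro n
    by_cases hn : i 1 < n
    · classical
      have hex : ∃ j, n ≤ i (j + 2) :=
        ⟨n, (hmono.id_le n).trans (hmono.monotone (by omega))⟩
      obtain ⟨j, hj1, hj2⟩ : ∃ j, i (j + 1) < n ∧ n ≤ i (j + 2) := by
        refine ⟨Nat.find hex, ?_, Nat.find_spec hex⟩
        rcases Nat.eq_zero_or_pos (Nat.find hex) with h0 | h0
        · rwa [h0]
        · have := Nat.find_min hex (show Nat.find hex - 1 < Nat.find hex by omega)
          rw [show Nat.find hex - 1 + 2 = Nat.find hex + 1 by omega] at this
          exact not_le.1 this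
      obtain ⟨l, hl⟩ := h.exists_lab_eq ((hmono (Nat.lt_succ_self j)).trans hj1)
      obtain ⟨v, hv1, hv2, -⟩ := h.exists_copy (show lab (wordTypeFrom lab m (s j)) l = n by
        rw [← hi, hl])
      refine ⟨wordMap φ m (s j) ∘ v, j, l, fun _ => ⟨hj1, hj2, hl,
        (h.isOpenEmbedding_wordMap _ _).comp hv1, ?_⟩⟩
      rw [range_comp, hv2, ← range_comp]
      rfl
    · exact ⟨fun _ => z, 0, 0, fun hn' => (hn hn').elim⟩
  choose v j l hv using hv
  have hle : ∀ n, i 1 < n → ∀ a, v n a ∈ range (wordMap φ m (l n :: s (j n))) :=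
    fun n hn a => (hv n hn).2.2.2.2 ▸ ⟨a, rfl⟩
  have hnot : ∀ n, i 1 < n → ∀ a, v n a ∉ range (wordMap φ m (s (j n + 1))) := by
    intro n hn a ha
    obtain ⟨x, hx⟩ := hle n hn a
    rw [hs] at ha
    obtain ⟨y, hy⟩ := ha
    refine h.wordMap_cons_ne m (s (j n)) (fun hlk => ?_) x y (hx.trans hy.symm)
    have h1 := (hv n hn).1
    rw [hi_succ, ← hlk, (hv n hn).2.2.1] at h1
    exact lt_irrefl _ h1
  -- The copy chosen at the deeper level lies inside the branch child that the other copy avoids.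
  have hjlt : ∀ n n', i 1 < n → i 1 < n' → j n < j n' → ∀ a b, v n a ≠ v n' b := by
    intro n n' hn hn' hj a b hab
    refine hnot n hn a (hanti (show j n + 1 ≤ j n' by omega) ?_)
    rw [hab]
    exact range_wordMap_cons_subset φ m _ _ (hle n' hn' b)
  refine ⟨i 1 + 1, v, fun n hn => (hv n hn).2.2.2.1, ?_, ?_, ?_⟩
  · rintro n hn ⟨a, ha⟩
    exact hnot n hn a (ha ▸ hz _)
  · intro n hn n' hn' a b hab
    rcases lt_trichotomy (j n) (j n') with hj | hj | hj
    · exact (hjlt n n' hn hn' hj a b hab).elim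
    · obtain ⟨x, hx⟩ := hle n hn a
      obtain ⟨y, hy⟩ := hle n' hn' b
      have hll : l n = l n' := by
        by_contra hne
        generalize j n' = j' at *
        subst hj
        exact h.wordMap_cons_ne m _ hne x y (by rw [hx, hy, hab])
      rw [← (hv n hn).2.2.1, ← (hv n' hn').2.2.1, hll, hj]
    · exact (hjlt n' n hn' hn hj b a hab.symm).elim
  · intro U hU
    obtain ⟨ε, hε, hεU⟩ := Metric.mem_nhds_iff.1 hU
    obtain ⟨N, hN⟩ := exists_pow_lt_of_lt_one hε (show (1 / 4 : ℝ) < 1 by norm_num)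
    refine eventually_atTop.2 ⟨max (i 1 + 1) (i (N + 2) + 1), fun n hn => ?_⟩
    have hn1 : i 1 < n := by omega
    have hjN : N ≤ j n := by
      by_contra hlt
      have h1 := hmono.monotone (show j n + 2 ≤ N + 2 by omega)
      have h2 := (hv n hn1).2.1
      omega
    rintro _ ⟨a, rfl⟩
    refine hεU (lt_of_le_of_lt (h.dist_le_of_mem_range_wordMap
      (range_wordMap_cons_subset φ m _ _ (hle n hn1 a)) (hz (j n))) (lt_of_le_of_lt ?_ hN))
    rw [hlen]
    exact pow_le_pow_of_le_one (by norm_num) (by norm_num) hjN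

theorem convergingCopies (h : TreeSystem lab T K φ d) {m : ℕ} (z : T m) :
    ConvergingCopies T z := by
  rcases h.core_or_branch z with ⟨f, x, hx, rfl⟩ | ⟨s, k, h1, h2, h3⟩
  · exact (h.convergingCopies_of_mem_core hx).map (h.isOpenEmbedding_wordMap m f)
  · exact h.convergingCopies_of_branch h1 h2 h3

/-! #### Nested limits -/

/-- Cantor's intersection theorem for the composites of `v` with the maps `ψ`, whose images are
compact and have diameter at most 4^{-(n-m)}. -/
theorem exists_nestedLimit [∀ n, CompactSpace (T n)] (h : TreeSystem lab T K φ d)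
    {ψ : ∀ n, T (n + 1) → T n} (hψ : ∀ n, IsOpenEmbedding (ψ n))
    (hψd : ∀ n x y, dist (ψ n x) (ψ n y) ≤ 1 / 4 * dist x y) {m q : ℕ} {v : T m → T q}
    (hv : IsOpenEmbedding v) (hvd : ∀ x y, dist (v x) (v y) ≤ dist x y) :
    ∃ x : T q, NestedLimit ψ x ∧ x ∈ range (v ∘ ψ m) := by
  obtain ⟨e, hem, he⟩ : ∃ e : ∀ n, T n → T q, e m = v ∧ ∀ n ≥ m, e (n + 1) = e n ∘ ψ n := by
    obtain ⟨z⟩ := h.nonempty q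
    -- The composite of `v` with the `ψ` from `m` up to `n`; for indices below `m` a constant map
    -- serves as an irrelevant default.
    let g : ∀ n, m ≤ n → T n → T q := fun n hn =>
      Nat.leRec (motive := fun n _ => T n → T q) v (fun n _ g => g ∘ ψ n) hn
    refine ⟨fun n => if hn : m ≤ n then g n hn else fun _ => z, ?_, fun n hn => ?_⟩
    · simp [g]
    · have hn' : m ≤ n := hn
      simp [hn', Nat.le_succ_of_le hn', g, Nat.leRec_succ]
  have hopen : ∀ n ≥ m, IsOpenEmbedding (e n) := by
    intro n hn
    induction n, hn using Nat.le_induction with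
    | base => rwa [hem]
    | succ n hn ih => rw [he n hn]; exact ih.comp (hψ n)
  have hdist : ∀ n ≥ m, ∀ x y, dist (e n x) (e n y) ≤ (1 / 4) ^ (n - m) := by
    have h1 : ∀ n ≥ m, ∀ x y, dist (e n x) (e n y) ≤ (1 / 4) ^ (n - m) * dist x y := by
      intro n hn
      induction n, hn using Nat.le_induction with
      | base => simpa [hem] using hvd
      | succ n hn ih =>
        intro x y
        rw [he n hn, Nat.succ_sub hn, pow_succ, mul_assoc]
        exact (ih _ _).trans (mul_le_mul_of_nonneg_left (hψd n x y) (by positivity))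
    exact fun n hn x y => (h1 n hn x y).trans
      (mul_le_of_le_one_right (by positivity) (h.dist_le_one _ _ _))
  obtain ⟨x, hx⟩ : (⋂ j, range (e (m + j))).Nonempty := by
    refine IsCompact.nonempty_iInter_of_sequence_nonempty_isCompact_isClosed _ (fun j => ?_)
      (fun j => ?_) (isCompact_range (hopen _ (by omega)).continuous)
      (fun j => (isCompact_range (hopen _ (by omega)).continuous).isClosed)
    · have := he (m + j) (by omega)
      rw [← add_assoc, this]
      exact range_comp_subset_range _ _
    · have := h.nonempty (m + j)
      exact range_nonempty _
  have hx' : ∀ n ≥ m, x ∈ range (e n) := by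
    intro n hn
    obtain ⟨j, rfl⟩ := Nat.exists_eq_add_of_le hn
    exact mem_iInter.1 hx j
  refine ⟨x, ⟨m, e, hopen, he, hx', fun U hU => ?_⟩, ?_⟩
  · obtain ⟨ε, hε, hεU⟩ := Metric.mem_nhds_iff.1 hU
    obtain ⟨N, hN⟩ := exists_pow_lt_of_lt_one hε (show (1 / 4 : ℝ) < 1 by norm_num)
    refine eventually_atTop.2 ⟨m + N, fun n hn => ?_⟩
    rintro _ ⟨a, rfl⟩
    obtain ⟨b, rfl⟩ := hx' n (by omega)
    refine hεU (lt_of_le_of_lt (hdist n (by omega) a b) (lt_of_le_of_lt ?_ hN))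
    exact pow_le_pow_of_le_one (by norm_num) (by norm_num) (by omega)
  · have := hx' (m + 1) (by omega)
    rwa [he m le_rfl, hem] at this

theorem not_reconstructible [∀ n, CompactSpace (T n)] (h : TreeSystem lab T K φ d) :
    ¬ Reconstructible (T 0) := by
  have hψ : ∀ n, ∃ v : T (n + 1) → T n, IsOpenEmbedding v ∧
      (∃ k, lab n k = n + 1 ∧ range v = range (φ n k)) ∧
      ∀ x y, dist (v x) (v y) ≤ 1 / 4 * dist x y := by
    intro n
    obtain ⟨k, hk⟩ := h.exists_lab_eq (Nat.lt_succ_self n)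
    obtain ⟨v, h1, h2, h3⟩ := h.exists_copy hk
    exact ⟨v, h1, ⟨k, hk, h2⟩, h3⟩
  choose ψ hψ hψr hψd using hψ
  -- The chain for `x` passes through a child of type 1 and the chain for `y` starts in a child of
  -- type 2, which keeps the two limits apart.
  obtain ⟨k, hk⟩ := h.exists_lab_eq (show 0 < 2 by omega)
  obtain ⟨v, hv, hvr, hvd⟩ := h.exists_copy hk
  obtain ⟨x, hx, hx'⟩ := h.exists_nestedLimit hψ hψd (v := (id : T 0 → T 0)) .id
    (fun _ _ => le_rfl)
  obtain ⟨y, hy, hy'⟩ := h.exists_nestedLimit hψ hψd hv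
    (fun a b => (hvd a b).trans (by linarith [dist_nonneg (x := a) (y := b)]))
  have : ∀ n, Nonempty (T n) := h.nonempty
  refine not_reconstructible_of_copies hψ ?_ hx hy h.convergingCopies
  rintro rfl
  obtain ⟨l, hl, hlr⟩ := hψr 0
  have h1 : x ∈ range (φ 0 l) := hlr ▸ hx'
  have h2 : x ∈ range (φ 0 k) := hvr ▸ range_comp_subset_range _ _ hy'
  obtain ⟨a, ha⟩ := h1
  obtain ⟨b, hb⟩ := h2
  refine h.child_ne 0 l k (fun hlk => ?_) a b (ha.trans hb.symm)
  rw [hlk, hk] at hl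
  omega

/-! #### Components -/

/-- The copy belonging to the word is clopen, and so is each child in it; together they cut off
everything but the continuum. -/
theorem connectedComponent_of_mem_core [∀ n, CompactSpace (T n)] (h : TreeSystem lab T K φ d)
    {m : ℕ} {f : List ℕ} {z : T m} (hz : z ∈ wordMap φ m f '' K (wordTypeFrom lab m f)) :
    connectedComponent z = wordMap φ m f '' K (wordTypeFrom lab m f) := by
  refine Subset.antisymm (fun w hw => ?_) ?_
  · obtain ⟨x, hx, rfl⟩ := hz
    obtain ⟨y, rfl⟩ := (h.isClopen_range_wordMap m f).connectedComponent_subset ⟨x, rfl⟩ hw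
    rcases h.core_or_child _ y with hy | ⟨k, y, rfl⟩
    · exact ⟨y, hy, rfl⟩
    · have hxc : wordMap φ m f x ∈ (range (wordMap φ m (k :: f)))ᶜ := by
        rintro ⟨u, hu⟩
        have : φ (wordTypeFrom lab m f) k u = x := (h.isOpenEmbedding_wordMap m f).injective hu
        exact h.child_notMem_core _ _ _ (this ▸ hx)
      exact ((h.isClopen_range_wordMap m (k :: f)).compl.connectedComponent_subset hxc hw
        ⟨y, rfl⟩).elim
  · exact ((h.isConnected_core _).image _
      (h.isOpenEmbedding_wordMap m f).continuous.continuousOn).isPreconnected.subset_connectedComponent hz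

/-- A point on an infinite branch lies in clopen sets of arbitrarily small diameter, so its
component is a single point. -/
theorem exists_core_of_nontrivial [∀ n, CompactSpace (T n)] (h : TreeSystem lab T K φ d)
    {m : ℕ} {z : T m} (hz : (connectedComponent z).Nontrivial) :
    ∃ f, z ∈ wordMap φ m f '' K (wordTypeFrom lab m f) := by
  rcases h.core_or_branch z with hf | ⟨s, k, h1, -, h3⟩
  · exact hf
  · obtain ⟨w, hw, hwz⟩ := hz.exists_ne z
    obtain ⟨N, hN⟩ := exists_pow_lt_of_lt_one (dist_pos.2 hwz) (show (1 / 4 : ℝ) < 1 by norm_num)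
    have := h.dist_le_of_mem_range_wordMap
      ((h.isClopen_range_wordMap m (s N)).connectedComponent_subset (h1 N) hw) (h1 N)
    rw [h3] at this
    linarith

/-- Deleting the last letter of a non-empty word gives a smaller type, and for each such type only
finitely many letters lead to `i`. -/
theorem finite_wordType_eq (h : TreeSystem lab T K φ d) (m i : ℕ) :
    {f | wordTypeFrom lab m f = i}.Finite := by
  induction i using Nat.strong_induction_on with
  | _ i ih =>
    refine ((Set.finite_singleton ([] : List ℕ)).union
      (Set.Finite.biUnion (Set.finite_lt_nat i) fun j hj => Set.Finite.image2 List.cons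
        (h.finite_lab_eq j i) (ih j hj))).subset ?_
    rintro (_ | ⟨k, f⟩) hf
    · exact Or.inl rfl
    · have hf' : lab (wordTypeFrom lab m f) k = i := hf
      refine Or.inr (mem_biUnion (x := wordTypeFrom lab m f) ?_ ⟨k, hf', f, rfl, rfl⟩)
      exact hf' ▸ h.lt_lab _ _

theorem finitelyRepeatedComponents [∀ n, CompactSpace (T n)] (h : TreeSystem lab T K φ d) (m : ℕ) :
    FinitelyRepeatedComponents (T m) := by
  intro x hx
  obtain ⟨f, hf⟩ := h.exists_core_of_nontrivial hx
  refine ((h.finite_wordType_eq m (wordTypeFrom lab m f)).image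
    fun g => wordMap φ m g '' K (wordTypeFrom lab m g)).subset ?_
  rintro _ ⟨⟨y, rfl⟩, ⟨e⟩⟩
  have hy : (connectedComponent y).Nontrivial := by
    rw [← nontrivial_coe_sort] at hx ⊢
    exact e.toEquiv.nontrivial
  obtain ⟨g, hg⟩ := h.exists_core_of_nontrivial hy
  refine ⟨g, ?_, (h.connectedComponent_of_mem_core hg).symm⟩
  by_contra hne
  rw [h.connectedComponent_of_mem_core hg, h.connectedComponent_of_mem_core hf] at e
  exact (h.not_homeomorphic _ _ hne).false
    ((((h.isOpenEmbedding_wordMap m g).isEmbedding.homeomorphImage _).trans e).trans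
      ((h.isOpenEmbedding_wordMap m f).isEmbedding.homeomorphImage _).symm)

end TreeSystem

/-! ### The spaces of the construction form a tree system -/

section

variable {E : ℕ → Set R3} {d : ℕ → ℕ → R3} {lab : ℕ → ℕ → ℕ}

theorem Admissible.subset_finSpaceFrom (h : Admissible E d lab) (n : ℕ) :
    E n ⊆ finSpaceFrom E d lab n := by
  rw [h.finSpaceFrom_eq]
  exact subset_union_left

theorem Admissible.smallCube_rel_subset (h : Admissible E d lab) (n k : ℕ) :
    (smallCube (d n) k).rel (finSpaceFrom E d lab (lab n k)) ⊆ finSpaceFrom E d lab n := by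
  rw [h.finSpaceFrom_eq n]
  exact (subset_iUnion (fun k => (smallCube (d n) k).rel (finSpaceFrom E d lab (lab n k))) k).trans
    subset_union_right

/-- The natural embedding of the copy in the `k`-th small cube. -/
noncomputable def Admissible.child (h : Admissible E d lab) (n k : ℕ) (x : finSpaceFrom E d lab (lab n k)) :
    finSpaceFrom E d lab n :=
  ⟨(smallCube (d n) k).aff x, h.smallCube_rel_subset n k ⟨x, x.2, rfl⟩⟩

theorem Admissible.isOpenEmbedding_child (h : Admissible E d lab) (n k : ℕ) :
    IsOpenEmbedding (h.child n k) := by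
  have hsq : ∀ k, d n k ∈ square := fun k => h.subset_square n (h.mem n k)
  have hcont : Continuous (h.child n k) :=
    ((smallCube (d n) k).continuous_aff.comp continuous_subtype_val).subtype_mk _
  have hinj : Function.Injective (h.child n k) := fun x y hxy =>
    Subtype.ext (Cube.aff_injective (smallCube_radius_pos _ _) (congrArg Subtype.val hxy))
  have : CompactSpace ↥(finSpaceFrom E d lab (lab n k)) :=
    isCompact_iff_compactSpace.1 (h.isCompact_finSpaceFrom _)
  refine ⟨(hcont.isClosedEmbedding hinj).isEmbedding, ?_⟩
  -- the union of the continuum and all other copies is closed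
  let P : ℕ → Set R3 := fun l =>
    if l = k then ∅ else (smallCube (d n) l).rel (finSpaceFrom E d lab (lab n l))
  have hP : ∀ l, P l ⊆ (smallCube (d n) l).rel (finSpaceFrom E d lab (lab n l)) := by
    intro l
    by_cases hl : l = k <;> simp [P, hl]
  have hclosed : IsClosed (E n ∪ ⋃ l, P l) := by
    refine isClosed_union_iUnion (h.isCompact n).isClosed (h.mem n) (fun l => ?_) ?_
    · by_cases hl : l = k
      · simp [P, hl]
      · simp only [P, hl, if_false]
        exact Cube.isClosed_rel (h.isClosed_finSpaceFrom _) (finSpaceFrom_subset _)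
    · intro l x hx
      obtain ⟨y, hy, rfl⟩ := hP l hx
      exact smallCube_aff_dist (finSpaceFrom_subset _ hy)
  have hrange : range (h.child n k) = (Subtype.val ⁻¹' (E n ∪ ⋃ l, P l))ᶜ := by
    ext x
    constructor
    · rintro ⟨y, rfl⟩ (hy | hy)
      · exact Set.disjoint_left.1 (square_disjoint_smallCube_rel (hsq k) (finSpaceFrom_subset _))
          (h.subset_square n hy) ⟨y, y.2, rfl⟩
      · obtain ⟨l, hl⟩ := mem_iUnion.1 hy
        have hlk : l ≠ k := by
          rintro rfl
          simp [P] at hl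
        exact Set.disjoint_left.1 (smallCube_rel_disjoint hsq hlk (finSpaceFrom_subset _)
          (finSpaceFrom_subset _)) (hP l hl) ⟨y, y.2, rfl⟩
    · intro hx
      rcases (h.finSpaceFrom_eq n).subset x.2 with hx2 | hx2
      · exact (hx (Or.inl hx2)).elim
      · obtain ⟨l, hl⟩ := mem_iUnion.1 hx2
        by_cases hlk : l = k
        · subst hlk
          obtain ⟨y, hy, hyx⟩ := hl
          exact ⟨⟨y, hy⟩, Subtype.ext hyx⟩
        · exact (hx (Or.inr (mem_iUnion.2 ⟨l, by simpa [P, hlk] using hl⟩))).elim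
  rw [hrange]
  exact (hclosed.preimage continuous_subtype_val).isOpen_compl

/-- The part of the continuum `E n` in the space that begins with it. -/
def core (E : ℕ → Set R3) (d : ℕ → ℕ → R3) (lab : ℕ → ℕ → ℕ) (n : ℕ) :
    Set (finSpaceFrom E d lab n) :=
  Subtype.val ⁻¹' E n

theorem Admissible.nonempty_homeomorph_core (h : Admissible E d lab) (n : ℕ) :
    Nonempty (↥(core E d lab n) ≃ₜ ↥(E n)) := by
  have himg : Subtype.val '' core E d lab n = E n := by
    rw [core, Subtype.image_preimage_coe, inter_eq_right]
    exact h.subset_finSpaceFrom n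
  exact ⟨(IsEmbedding.subtypeVal.homeomorphImage _).trans (Homeomorph.setCongr himg)⟩

theorem Admissible.treeSystem (h : Admissible E d lab) :
    TreeSystem lab (fun n => ↥(finSpaceFrom E d lab n)) (core E d lab) h.child
      (fun n k => ⟨d n k, h.subset_finSpaceFrom n (h.mem n k)⟩) where
  isOpenEmbedding := h.isOpenEmbedding_child
  dist_le_one n x y := by
    have hx : dist (x : R3) mid ≤ 1 / 2 := finSpaceFrom_subset n x.2
    have hy : dist (y : R3) mid ≤ 1 / 2 := finSpaceFrom_subset n y.2
    refine (dist_triangle_right (x : R3) y mid).trans (by linarith)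
  dist_child_le n k x y := by
    refine (Cube.dist_aff (smallCube_radius_pos _ _) (x : R3) y).trans_le ?_
    rw [two_mul_smallCube_radius]
    exact mul_le_mul_of_nonneg_right (quarter_pow_le k) dist_nonneg
  child_ne n k l hkl x y hxy :=
    smallCube_aff_ne (fun k => h.subset_square n (h.mem n k)) hkl (finSpaceFrom_subset _ x.2)
      (finSpaceFrom_subset _ y.2) (congrArg Subtype.val hxy)
  core_or_child n x := by
    rcases (h.finSpaceFrom_eq n).subset x.2 with hx | hx
    · exact Or.inl hx
    · obtain ⟨k, y, hy, hyx⟩ := mem_iUnion.1 hx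
      exact Or.inr ⟨k, ⟨y, hy⟩, Subtype.ext hyx⟩
  child_notMem_core n k x hx :=
    Set.disjoint_left.1 (square_disjoint_smallCube_rel (h.subset_square n (h.mem n k))
      (finSpaceFrom_subset _)) (h.subset_square n hx) ⟨x, x.2, rfl⟩
  dist_child_point n k x := smallCube_aff_dist (finSpaceFrom_subset _ x.2)
  isConnected_core n := by
    obtain ⟨e⟩ := h.nonempty_homeomorph_core n
    have := isConnected_iff_connectedSpace.1 (h.isConnected n)
    exact isConnected_iff_connectedSpace.2 (e.symm.surjective.connectedSpace e.symm.continuous)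
  not_homeomorphic i j hij := by
    obtain ⟨e⟩ := h.nonempty_homeomorph_core i
    obtain ⟨e'⟩ := h.nonempty_homeomorph_core j
    exact ⟨fun g => (h.not_homeomorphic i j hij).false ((e.symm.trans g).trans e')⟩
  lab_monotone := h.lab_monotone
  range_lab := h.range_lab
  block_dense n m hnm x hx := h.block_dense n m hnm x hx

theorem Admissible.conclusion (h : Admissible E d lab) :
    CompactSpace ↥(finSpace E d lab) ∧ ¬ Reconstructible ↥(finSpace E d lab) ∧
      FinitelyRepeatedComponents ↥(finSpace E d lab) := by
  have : ∀ n, CompactSpace ↥(finSpaceFrom E d lab n) := fun n =>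
    isCompact_iff_compactSpace.1 (h.isCompact_finSpaceFrom n)
  rw [← finSpaceFrom_zero]
  exact ⟨this 0, h.treeSystem.not_reconstructible, h.treeSystem.finitelyRepeatedComponents 0⟩

end

/-! ### Enumerations with dense blocks -/

/-- By compactness some initial segment of a dense sequence is 2^{-m}-dense. Concatenating one such
segment for each m > n gives the blocks. -/
theorem exists_dense_blocks {E : Set R3} (hE : IsCompact E) (hne : E.Nonempty) (n : ℕ) :
    ∃ (d : ℕ → R3) (lab : ℕ → ℕ), (∀ k, d k ∈ E) ∧ Monotone lab ∧ range lab = Ioi n ∧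
      ∀ m, n < m → ∀ x ∈ E, ∃ k, lab k = m ∧ dist x (d k) ≤ (1 / 2) ^ m := by
  have := hne.to_subtype
  have := isCompact_iff_compactSpace.1 hE
  have hN : ∀ j, ∃ N, ∀ x : E, ∃ k < N,
      dist x (TopologicalSpace.denseSeq E k) ≤ (1 / 2) ^ (n + 1 + j) := by
    intro j
    obtain ⟨t, ht⟩ := (isCompact_univ (X := E)).elim_finite_subcover
      (fun k => Metric.ball (TopologicalSpace.denseSeq E k) ((1 / 2) ^ (n + 1 + j)))
      (fun _ => Metric.isOpen_ball) (fun x _ => by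
        obtain ⟨k, hk⟩ := (TopologicalSpace.denseRange_denseSeq E).exists_dist_lt x
          (show (0 : ℝ) < (1 / 2) ^ (n + 1 + j) by positivity)
        exact mem_iUnion.2 ⟨k, hk⟩)
    refine ⟨t.sup id + 1, fun x => ?_⟩
    obtain ⟨k, hk, hx⟩ := mem_iUnion₂.1 (ht (mem_univ x))
    exact ⟨k, Nat.lt_succ_of_le (Finset.le_sup (f := id) hk), le_of_lt hx⟩
  choose N hN using hN
  have hNpos : ∀ j, 0 < N j := fun j => by
    obtain ⟨k, hk, -⟩ := hN j ⟨_, hne.some_mem⟩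
    omega
  let b : ℕ → ℕ := fun j => ∑ i ∈ Finset.range j, N i
  have hbs : ∀ j, b (j + 1) = b j + N j := fun j => Finset.sum_range_succ _ _
  have hb : StrictMono b := strictMono_nat_of_lt_succ fun j => by
    have := hNpos j
    rw [hbs]; omega
  -- The number of the block containing position `k`, where block `j` starts at `b j`. Searching up
  -- to `k` suffices because j ≤ `b j`.
  let J : ℕ → ℕ := fun k => Nat.findGreatest (fun j => b j ≤ k) k
  have hJ : ∀ j l, l < N j → J (b j + l) = j := by
    intro j l hl
    refine (Nat.findGreatest_eq_iff).2 ⟨(hb.id_le j).trans (Nat.le_add_right _ _),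
      fun _ => Nat.le_add_right _ _, fun i hi _ => ?_⟩
    have := hb.monotone (show j + 1 ≤ i from hi)
    rw [hbs] at this
    omega
  refine ⟨fun k => TopologicalSpace.denseSeq E (k - b (J k)), fun k => n + 1 + J k,
    fun k => Subtype.coe_prop _, fun k l hkl => ?_, ?_, fun m hm x hx => ?_⟩
  · exact Nat.add_le_add_left (Nat.findGreatest_mono (fun i hi => le_trans hi hkl) hkl) _
  · ext m
    constructor
    · rintro ⟨k, rfl⟩
      exact Nat.lt_of_lt_of_le (Nat.lt_succ_self n) (Nat.le_add_right _ _)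
    · intro hm
      obtain ⟨j, rfl⟩ := Nat.exists_eq_add_of_le (show n + 1 ≤ m from hm)
      exact ⟨b j + 0, congrArg (n + 1 + ·) (hJ j 0 (hNpos j))⟩
  · obtain ⟨j, rfl⟩ := Nat.exists_eq_add_of_le (show n + 1 ≤ m from hm)
    obtain ⟨l, hl, hxl⟩ := hN j ⟨x, hx⟩
    refine ⟨b j + l, congrArg (n + 1 + ·) (hJ j l hl), ?_⟩
    simp only [hJ j l hl, Nat.add_sub_cancel_left]
    exact hxl

/-! ### Stars -/

/-- The point with parameter `t` on the leg with slope `s`. -/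
noncomputable def legPoint (s t : ℝ) : R3 := ![1 / 2 + t / 4, 1 / 2 + t * s / 4, 1 / 2]

/-- The star in the plane with legs of the slopes in `F`. -/
def star (F : Finset ℝ) : Set R3 := ⋃ s ∈ F, legPoint s '' Icc 0 1

theorem continuous_legPoint (s : ℝ) : Continuous (legPoint s) := by
  unfold legPoint
  refine continuous_pi fun i => ?_
  fin_cases i <;> simp <;> fun_prop

theorem legPoint_zero (s : ℝ) : legPoint s 0 = mid := by
  ext i
  fin_cases i <;> simp [legPoint, mid]

theorem legPoint_mem_star {F : Finset ℝ} {s t : ℝ} (hs : s ∈ F) (ht : t ∈ Icc (0 : ℝ) 1) :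
    legPoint s t ∈ star F :=
  mem_biUnion (Finset.mem_coe.2 hs) ⟨t, ht, rfl⟩

theorem exists_of_mem_star {F : Finset ℝ} {x : R3} (hx : x ∈ star F) :
    ∃ s ∈ F, ∃ t ∈ Icc (0 : ℝ) 1, legPoint s t = x := by
  obtain ⟨s, hs, t, ht, rfl⟩ := mem_iUnion₂.1 hx
  exact ⟨s, hs, t, ht, rfl⟩

theorem legPoint_eq {s s' t t' : ℝ} (h : legPoint s t = legPoint s' t') :
    t = t' ∧ (t = 0 ∨ s = s') := by
  have h0 := congrFun h 0
  have h1 := congrFun h 1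
  simp [legPoint] at h0 h1
  subst h0
  refine ⟨rfl, ?_⟩
  rwa [mul_eq_mul_left_iff, or_comm] at h1

theorem star_subset_square {F : Finset ℝ} (hF : ∀ s ∈ F, s ∈ Icc (0 : ℝ) 1) : star F ⊆ square := by
  intro x hx
  obtain ⟨s, hs, t, ⟨ht0, ht1⟩, rfl⟩ := exists_of_mem_star hx
  obtain ⟨hs0, hs1⟩ := hF s hs
  have h1 : 0 ≤ t * s := by positivity
  have h2 : t * s ≤ 1 := mul_le_one₀ ht1 hs0 hs1
  refine ⟨⟨?_, ?_⟩, ⟨?_, ?_⟩, ?_⟩ <;> simp [legPoint] <;> linarith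

theorem isCompact_star (F : Finset ℝ) : IsCompact (star F) :=
  F.finite_toSet.isCompact_biUnion fun s _ => isCompact_Icc.image (continuous_legPoint s)

theorem isConnected_star {F : Finset ℝ} (hF : F.Nonempty) : IsConnected (star F) := by
  obtain ⟨s₀, hs₀⟩ := hF
  have hmid : ∀ s ∈ F, mid ∈ legPoint s '' Icc 0 1 := fun s _ =>
    ⟨0, ⟨le_rfl, zero_le_one⟩, legPoint_zero s⟩
  refine ⟨⟨mid, mem_biUnion hs₀ (hmid s₀ hs₀)⟩, isPreconnected_of_forall mid fun y hy => ?_⟩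
  obtain ⟨s, hs, hy⟩ := mem_iUnion₂.1 hy
  exact ⟨_, subset_biUnion_of_mem (u := fun s => legPoint s '' Icc 0 1) hs, hmid s hs, hy,
    isPreconnected_Icc.image _ (continuous_legPoint s).continuousOn⟩

theorem nontrivial_star {F : Finset ℝ} (hF : F.Nonempty) : (star F).Nontrivial := by
  obtain ⟨s, hs⟩ := hF
  refine ⟨_, legPoint_mem_star hs ⟨le_rfl, zero_le_one⟩, _,
    legPoint_mem_star hs ⟨zero_le_one, le_rfl⟩, fun h => ?_⟩
  exact zero_ne_one (legPoint_eq h).1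

/-- On the complement of some point there is a continuous real function with exactly `n` values. -/
def HasCut (n : ℕ) (Y : Type) [TopologicalSpace Y] : Prop :=
  ∃ (q : Y) (g : Y → ℝ), ContinuousOn g {q}ᶜ ∧ (g '' {q}ᶜ).Finite ∧ (g '' {q}ᶜ).ncard = n

theorem HasCut.of_homeomorph {n : ℕ} {Y Z : Type} [TopologicalSpace Y] [TopologicalSpace Z]
    (h : HasCut n Y) (e : Y ≃ₜ Z) : HasCut n Z := by
  obtain ⟨q, g, hg, hfin, hn⟩ := h
  have himg : (g ∘ e.symm) '' {e q}ᶜ = g '' {q}ᶜ := by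
    rw [image_comp]
    congr 1
    ext y
    constructor
    · rintro ⟨z, hz, rfl⟩ h
      exact hz (e.symm_apply_eq.1 h)
    · exact fun hy => ⟨e y, fun h => hy (e.injective h), e.symm_apply_apply y⟩
  refine ⟨e q, g ∘ e.symm, hg.comp e.symm.continuous.continuousOn ?_, himg ▸ hfin, himg ▸ hn⟩
  exact fun z hz h => hz (e.symm_apply_eq.1 h)

/-- Off the centre, the slope seen from the centre is continuous and is constant on each leg. -/
theorem hasCut_star {F : Finset ℝ} (hF : F.Nonempty) : HasCut F.card (star F) := by
  obtain ⟨s₀, hs₀⟩ := hF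
  have hmem : mid ∈ star F := legPoint_zero s₀ ▸ legPoint_mem_star hs₀ ⟨le_rfl, zero_le_one⟩
  have hslope : ∀ s t, t ≠ 0 →
      (legPoint s t 1 - 1 / 2) / (legPoint s t 0 - 1 / 2) = s := by
    intro s t ht
    simp only [legPoint, Matrix.cons_val]
    field_simp
    ring
  have himg : (fun y : star F => ((y : R3) 1 - 1 / 2) / ((y : R3) 0 - 1 / 2)) ''
      {(⟨mid, hmem⟩ : star F)}ᶜ = F := by
    ext s
    constructor
    · rintro ⟨⟨y, hy⟩, hym, rfl⟩
      obtain ⟨s, hs, t, ht, rfl⟩ := exists_of_mem_star hy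
      have ht0 : t ≠ 0 := by
        rintro rfl
        exact hym (Subtype.ext (legPoint_zero s))
      simp only [hslope s t ht0]
      exact hs
    · intro hs
      refine ⟨⟨legPoint s 1, legPoint_mem_star hs ⟨zero_le_one, le_rfl⟩⟩, fun h => ?_,
        hslope s 1 one_ne_zero⟩
      have h2 : legPoint s 1 = legPoint s 0 := (congrArg Subtype.val h).trans (legPoint_zero s).symm
      exact one_ne_zero (legPoint_eq h2).1
  refine ⟨⟨mid, hmem⟩, fun y => ((y : R3) 1 - 1 / 2) / ((y : R3) 0 - 1 / 2), ?_, ?_, ?_⟩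
  · refine ContinuousOn.div
      (((continuous_apply 1).comp continuous_subtype_val).sub continuous_const).continuousOn
      (((continuous_apply 0).comp continuous_subtype_val).sub continuous_const).continuousOn ?_
    rintro ⟨y, hy⟩ hym h
    obtain ⟨s, hs, t, ht, rfl⟩ := exists_of_mem_star hy
    have ht0 : t = 0 := by simpa [legPoint] using h
    subst ht0
    exact hym (Subtype.ext (legPoint_zero s))
  · rw [himg]; exact F.finite_toSet
  · rw [himg, ncard_coe_finset]

/-- A continuous function with finitely many values is constant on connected sets. Removing the
centre leaves one connected piece for each leg; removing any other point leaves at most two pieces.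
-/
theorem HasCut.le_card {F : Finset ℝ} {n : ℕ} (h : HasCut n (star F)) : n ≤ max F.card 2 := by
  classical
  obtain ⟨⟨q, hq⟩, g, hg, hfin, rfl⟩ := h
  -- extend `g` to the whole space to evaluate it on the legs
  obtain ⟨G, hG⟩ : ∃ G : R3 → ℝ, ∀ y : star F, G y = g y :=
    ⟨fun y => if hy : y ∈ star F then g ⟨y, hy⟩ else 0, fun y => by simp⟩
  have himg : g '' {(⟨q, hq⟩ : star F)}ᶜ = G '' (star F \ {q}) := by
    ext r
    constructor
    · rintro ⟨y, hy, rfl⟩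
      exact ⟨y, ⟨y.2, fun h => hy (Subtype.ext h)⟩, hG y⟩
    · rintro ⟨y, ⟨hy, hyq⟩, rfl⟩
      exact ⟨⟨y, hy⟩, fun h => hyq (congrArg Subtype.val h), (hG ⟨y, hy⟩).symm⟩
  have hGc : ContinuousOn G (star F \ {q}) := by
    rw [continuousOn_iff_continuous_domRestrict] at hg ⊢
    have hmap : Continuous fun y : ↥(star F \ {q}) =>
        (⟨⟨y, y.2.1⟩, fun h => y.2.2 (congrArg Subtype.val h)⟩ :
          ↥({(⟨q, hq⟩ : star F)}ᶜ : Set (star F))) :=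
      (continuous_subtype_val.subtype_mk _).subtype_mk _
    refine (hg.comp hmap).congr fun y => ?_
    exact (hG ⟨y, y.2.1⟩).symm
  rw [himg] at hfin ⊢
  have hconst : ∀ s ∈ F, ∀ J : Set ℝ, J.OrdConnected → J ⊆ Icc 0 1 →
      (∀ t ∈ J, legPoint s t ≠ q) → ∀ t ∈ J, ∀ t' ∈ J,
      G (legPoint s t) = G (legPoint s t') := by
    intro s hs J hJ hJI hJq t ht t' ht'
    have hsub : legPoint s '' J ⊆ star F \ {q} := by
      rintro _ ⟨r, hr, rfl⟩
      exact ⟨legPoint_mem_star hs (hJI hr), hJq r hr⟩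
    have hpre : IsPreconnected (G '' (legPoint s '' J)) :=
      (hJ.isPreconnected.image _ (continuous_legPoint s).continuousOn).image _ (hGc.mono hsub)
    by_contra hne
    exact hpre.infinite_of_nontrivial
      ⟨_, ⟨_, ⟨t, ht, rfl⟩, rfl⟩, _, ⟨_, ⟨t', ht', rfl⟩, rfl⟩, hne⟩
      (hfin.subset (image_mono hsub))
  obtain ⟨s₀, hs₀, t₀, ht₀, rfl⟩ := exists_of_mem_star hq
  rcases eq_or_lt_of_le ht₀.1 with h0 | h0
  · subst h0
    refine le_max_of_le_left ?_
    have hsub : G '' (star F \ {legPoint s₀ 0}) ⊆ ↑(F.image fun s => G (legPoint s 1)) := by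
      rintro _ ⟨y, ⟨hy, hyq⟩, rfl⟩
      obtain ⟨s, hs, t, ht, rfl⟩ := exists_of_mem_star hy
      have ht0 : 0 < t := lt_of_le_of_ne ht.1 (by
        rintro rfl
        exact hyq ((legPoint_zero s).trans (legPoint_zero s₀).symm))
      refine Finset.mem_coe.2 (Finset.mem_image.2 ⟨s, hs, ?_⟩)
      exact hconst s hs (Ioc 0 1) ordConnected_Ioc Ioc_subset_Icc_self
        (fun r hr h => hr.1.ne' (legPoint_eq h).1) 1 ⟨one_pos, le_rfl⟩ t ⟨ht0, ht.2⟩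
    refine (ncard_le_ncard hsub (Finset.finite_toSet _)).trans ?_
    rw [ncard_coe_finset]
    exact Finset.card_image_le
  · refine le_max_of_le_right ?_
    -- One piece contains the centre, and the other is the outer end of the leg of the removed
    -- point. It may be empty, in which case the second value is harmless.
    have hsub : G '' (star F \ {legPoint s₀ t₀}) ⊆ {G mid, G (legPoint s₀ 1)} := by
      rintro _ ⟨y, ⟨hy, hyq⟩, rfl⟩
      obtain ⟨s, hs, t, ht, rfl⟩ := exists_of_mem_star hy
      rcases eq_or_ne s s₀ with rfl | hss
      · rcases lt_trichotomy t t₀ with htt | htt | htt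
        · left
          rw [← legPoint_zero s]
          exact hconst s hs (Ico 0 t₀) ordConnected_Ico (fun r hr => ⟨hr.1, hr.2.le.trans ht₀.2⟩)
            (fun r hr h => hr.2.ne (legPoint_eq h).1) t ⟨ht.1, htt⟩ 0 ⟨le_rfl, h0⟩
        · exact (hyq (by rw [htt]; rfl)).elim
        · right
          exact hconst s hs (Ioc t₀ 1) ordConnected_Ioc (fun r hr => ⟨h0.le.trans hr.1.le, hr.2⟩)
            (fun r hr h => hr.1.ne' (legPoint_eq h).1) t ⟨htt, ht.2⟩ 1
            ⟨htt.trans_le ht.2, le_rfl⟩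
      · left
        rw [← legPoint_zero s]
        refine hconst s hs (Icc 0 1) ordConnected_Icc subset_rfl (fun r hr h => ?_) t ht 0
          ⟨le_rfl, zero_le_one⟩
        obtain ⟨h1, h2⟩ := legPoint_eq h
        rcases h2 with h2 | h2
        · exact h0.ne (h2.symm.trans h1)
        · exact hss h2
    exact (ncard_le_ncard hsub (toFinite _)).trans ((ncard_insert_le _ _).trans (by simp))

/-! ### Admissible input exists -/

/-- The slopes of the legs of the `n`-th star. -/
noncomputable def slopes (n : ℕ) : Finset ℝ :=
  (Finset.range (n + 3)).image fun i : ℕ => (1 : ℝ) / (i + 1)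

theorem card_slopes (n : ℕ) : (slopes n).card = n + 3 := by
  rw [slopes, Finset.card_image_of_injective, Finset.card_range]
  intro i j hij
  have : (i : ℝ) + 1 = j + 1 := by simpa using hij
  exact_mod_cast add_right_cancel this

theorem slopes_subset (n : ℕ) : ∀ s ∈ slopes n, s ∈ Icc (0 : ℝ) 1 := by
  intro s hs
  obtain ⟨i, -, rfl⟩ := Finset.mem_image.1 hs
  exact ⟨by positivity, (div_le_one (by positivity)).2 (by simp)⟩

theorem slopes_nonempty (n : ℕ) : (slopes n).Nonempty :=
  Finset.card_pos.1 (by rw [card_slopes]; omega)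

/-- All these stars have at least three legs, so the maximum with 2 in `HasCut.le_card` plays no
role. -/
theorem le_of_homeomorph_star {i j : ℕ} (e : star (slopes i) ≃ₜ star (slopes j)) : i ≤ j := by
  have := ((hasCut_star (slopes_nonempty i)).of_homeomorph e).le_card
  rw [card_slopes, card_slopes] at this
  omega

theorem exists_admissible : ∃ (E : ℕ → Set R3) (d : ℕ → ℕ → R3) (lab : ℕ → ℕ → ℕ),
    Admissible E d lab := by
  choose d lab hd hmono hrange hblock using fun n => exists_dense_blocks
    (isCompact_star (slopes n)) (isConnected_star (slopes_nonempty n)).nonempty n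
  refine ⟨fun n => star (slopes n), d, lab, fun n => star_subset_square (slopes_subset n),
    fun n => isCompact_star _, fun n => isConnected_star (slopes_nonempty n),
    fun n => nontrivial_star (slopes_nonempty n), fun i j hij => ⟨fun e => hij ?_⟩, hd,
    fun n x hx => ?_, hmono, hrange, hblock⟩
  · exact le_antisymm (le_of_homeomorph_star e) (le_of_homeomorph_star e.symm)
  · refine Metric.mem_closure_iff.2 fun ε hε => ?_
    obtain ⟨N, hN⟩ := exists_pow_lt_of_lt_one hε (show (1 / 2 : ℝ) < 1 by norm_num)
    obtain ⟨k, -, hk⟩ := hblock n (n + 1 + N) (by omega) x hx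
    refine ⟨_, ⟨k, rfl⟩, (hk.trans ?_).trans_lt hN⟩
    exact pow_le_pow_of_le_one (by norm_num) (by norm_num) (by omega)

end Recon
theorem theorem6p10 :
    (∃ (E : ℕ → Set Recon.R3) (d : ℕ → ℕ → Recon.R3) (lab : ℕ → ℕ → ℕ),
      Recon.Admissible E d lab) ∧
    ∀ (E : ℕ → Set Recon.R3) (d : ℕ → ℕ → Recon.R3) (lab : ℕ → ℕ → ℕ),
      Recon.Admissible E d lab →
        CompactSpace ↥(Recon.finSpace E d lab) ∧
        TopologicalSpace.MetrizableSpace ↥(Recon.finSpace E d lab) ∧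
        ¬ Recon.Reconstructible ↥(Recon.finSpace E d lab) ∧
        Recon.FinitelyRepeatedComponents ↥(Recon.finSpace E d lab) := by
  refine ⟨Recon.exists_admissible, fun E d lab h => ?_⟩
  obtain ⟨hc, hr, hf⟩ := h.conclusion
  exact ⟨hc, inferInstance, hr, hf⟩
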